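/- Setting. Let $d\in\mathbb N$, let $A$ be a real $d\times d$ matrix with Euclidean operator norm $\|A\|$, let $T>0$, $R_0>0$, and let $\alpha_0,\mu_0$ be Borel probability measures on $\mathbb R^d$ supported on $B_{R_0}$, where $B_r$ is the closed ball of radius $r$ centered at $0$. $\Pi(\alpha,\mu)$ denotes the set of Borel measures on $\mathbb R^d\times\mathbb R^d$ with marginals $\alpha$ and $\mu$; $W_2^2(\alpha,\mu)=\inf_{\gamma\in\Pi(\alpha,\mu)}\int|x-y|^2\,\gamma(dx,dy)$; a minimizer is called an optimal plan. For $\varepsilon>0$, $$\mathrm{OT}_\varepsilon(\alpha,\mu)=\inf_{\gamma\in\Pi(\alpha,\mu)}\Big\{\tfrac12\int|x-y|^2\,\gamma(dx,dy)+\varepsilon H(\gamma\,|\,\alpha\otimes\mu)\Big\},$$ where $H(p|q)=\int\log\frac{dp}{dq}\,dp$ if $p\ll q$ and $H(p|q)=+\infty$ otherwise. For compactly supported probability measures $\alpha,\mu$ let $\gamma^\varepsilon$ be the (unique) solution of $\mathrm{OT}_\varepsilon(\alpha,\mu)$, let $\gamma^\varepsilon(dx,dy)=\alpha(dx)\,\gamma^\varepsilon(dy|x)$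 be its disintegration, and set $$B^{\varepsilon}_{\mu}[\alpha](x)=A\Big(x-\int y\,\gamma^\varepsilon(dy|x)\Big).$$ Weak solutions. A weak solution on $[0,T]\times\mathbb R^d$ of $$\partial_t\alpha+\operatorname{div}(\alpha A(\mathrm{id}-\nabla\psi))=0,\quad \alpha(0,\cdot)=\alpha_0,\quad \det(D^2\psi_t)\,\mu_0(\nabla\psi_t)=\alpha_t,\quad \psi_t\text{ convex},\tag{sg3}$$ is a $W_2$-continuous curve $t\in[0,T]\mapsto\alpha_t$ of probability measures, equal to $\alpha_0$ at $t=0$, with $\operatorname{spt}\alpha_t\subset B_{2R_0e^{\|A\|T}}$ for every $t\in[0,T]$, for which there is a measurable family $(\gamma_t)_t$ such that $\gamma_t$ is an optimal plan between $\alpha_t$ and $\mu_0$ for a.e. $t\in[0,T]$ and, for every $f\in C^1([0,T]\times\mathbb R^d)$, $$\int_0^T\!\!\int[\partial_tf+Ax\cdot\nabla f]\,\alpha_t(dx)\,dt-\int_0^T\!\!\int Ay\cdot\nabla f(t,x)\,\gamma_t(dx,dy)\,dt=\int f(T,x)\,\alpha_T(dx)-\int f(0,x)\,\alpha_0(dx).$$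 Scheme. For each $\varepsilon>0$ let $N_\varepsilon,M_\varepsilon\ge1$ be integers, $\tau_\varepsilon=T/N_\varepsilon$, and let $$\tilde\alpha_0^\varepsilon=\frac1{M_\varepsilon}\sum_{i=1}^{M_\varepsilon}\delta_{x_i^\varepsilon},\qquad \tilde\mu_0^\varepsilon=\frac1{M_\varepsilon}\sum_{i=1}^{M_\varepsilon}\delta_{y_i^\varepsilon},\qquad x_i^\varepsilon,y_i^\varepsilon\in B_{R_0}.$$ Define $\alpha_0^\varepsilon=\tilde\alpha_0^\varepsilon$, $\alpha_{k+1}^\varepsilon=\big(\mathrm{id}+\tau_\varepsilon B^\varepsilon_{\tilde\mu_0^\varepsilon}[\alpha_k^\varepsilon]\big)_\#\alpha_k^\varepsilon$, and $\tilde\alpha_t^\varepsilon=\alpha_k^\varepsilon$ for $t\in[k\tau_\varepsilon,(k+1)\tau_\varepsilon)$, $k=0,\dots,N_\varepsilon-1$. Theorem. Assume that $$\tau_\varepsilon+W_2(\alpha_0,\tilde\alpha_0^\varepsilon)+W_2(\mu_0,\tilde\mu_0^\varepsilon)\to0\quad\text{as }\varepsilon\to0^+.$$ Let $t\in[0,T]\mapsto\alpha_t$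 be a $W_2$-continuous curve of Borel probability measures on $\mathbb R^d$ which is a uniform cluster point of the curves $\tilde\alpha^\varepsilon$, that is, for some sequence $\varepsilon_n\to0^+$, $$\sup_{t\in[0,T)}W_2(\tilde\alpha_t^{\varepsilon_n},\alpha_t)\to0\quad\text{as }n\to\infty.$$ Then $\alpha$ is a weak solution of (sg3) on $[0,T]\times\mathbb R^d$. -/

import Mathlib

open MeasureTheory Filter Topology
open scoped ENNReal

noncomputable section

namespace SemiGeo

/-- Euclidean space `ℝ^d`, with the Euclidean norm and its Borel σ-algebra. -/
abbrev Eucl (d : ℕ) : Type := EuclideanSpace ℝ (Fin d)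

variable {d : ℕ}

/-- `𝒫(B_R)`: Borel probability measures on `ℝ^d` that are supported on the closed ball `B_R`
of radius `R` centered at `0`. -/
def probBall (d : ℕ) (R : ℝ) : Set (Measure (Eucl d)) :=
  {α | IsProbabilityMeasure α ∧ α (Metric.closedBall 0 R)ᶜ = 0}

/-- `Π(α, μ)`: the transport plans, i.e. the Borel measures on `ℝ^d × ℝ^d` with first marginal `α`
and second marginal `μ`. -/
def plans (α μ : Measure (Eucl d)) : Set (Measure (Eucl d × Eucl d)) :=
  {γ | γ.fst = α ∧ γ.snd = μ}

/-- The quadratic cost `∫ |x - y|² γ(dx, dy)`, with values in `[0, ∞]`. -/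
def quadCost (γ : Measure (Eucl d × Eucl d)) : ℝ≥0∞ :=
  ∫⁻ p, ‖p.1 - p.2‖ₑ ^ 2 ∂γ

/-- The squared 2-Wasserstein distance: the value of the quadratic optimal transport problem. -/
def W2sq (α μ : Measure (Eucl d)) : ℝ≥0∞ :=
  ⨅ γ ∈ plans α μ, quadCost γ

/-- The 2-Wasserstein distance. -/
def W2 (α μ : Measure (Eucl d)) : ℝ≥0∞ :=
  (W2sq α μ) ^ (1 / 2 : ℝ)

/-- `γ` is an optimal plan for the quadratic optimal transport problem between `α` and `μ`. -/
def IsOptimalPlan (α μ : Measure (Eucl d)) (γ : Measure (Eucl d × Eucl d)) : Prop :=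
  γ ∈ plans α μ ∧ quadCost γ = W2sq α μ

/-- The entropic functional `½ ∫ |x - y|² dγ + ε H(γ | α ⊗ μ)`. For probability measures,
`klDiv p q` is the relative entropy: `∫ log (dp/dq) dp` if `p ≪ q`, and `∞` otherwise. -/
def entropicCost (ε : ℝ) (α μ : Measure (Eucl d)) (γ : Measure (Eucl d × Eucl d)) : ℝ≥0∞ :=
  2⁻¹ * quadCost γ + ENNReal.ofReal ε * InformationTheory.klDiv γ (α.prod μ)

/-- The value `OT_ε(α, μ)` of the entropic optimal transport problem. -/
def OTeps (ε : ℝ) (α μ : Measure (Eucl d)) : ℝ≥0∞ :=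
  ⨅ γ ∈ plans α μ, entropicCost ε α μ γ

/-- `γ` solves the entropic optimal transport problem `OT_ε(α, μ)`. -/
def IsEntropicPlan (ε : ℝ) (α μ : Measure (Eucl d)) (γ : Measure (Eucl d × Eucl d)) : Prop :=
  γ ∈ plans α μ ∧ entropicCost ε α μ γ = OTeps ε α μ

/-- The solution `γ^ε` of `OT_ε(α, μ)`; it exists and is unique when `ε > 0` and `α`, `μ` are
compactly supported probability measures (the only case in which it is used). -/
def entropicPlan (ε : ℝ) (α μ : Measure (Eucl d)) : ProbabilityMeasure (Eucl d × Eucl d) :=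
  Classical.epsilon fun γ : ProbabilityMeasure (Eucl d × Eucl d) =>
    IsEntropicPlan ε α μ (γ : Measure (Eucl d × Eucl d))

/-- The velocity `B^ε[α](x) = A (x - ∫ y γ^ε(dy | x))`, where `γ^ε(dy | x)` is the disintegration
with respect to its first marginal `α` of the solution `γ^ε` of `OT_ε(α, μ)`. -/
def velocity (A : Eucl d →L[ℝ] Eucl d) (ε : ℝ) (μ α : Measure (Eucl d)) (x : Eucl d) : Eucl d :=
  A (x - ∫ y, y ∂((entropicPlan ε α μ : Measure (Eucl d × Eucl d)).condKernel x))

/-- The explicit Euler scheme with time step `τ`: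
`α_0 = a`, `α_{k+1} = (id + τ B^ε[α_k])_# α_k`. -/
def euler (A : Eucl d →L[ℝ] Eucl d) (ε τ : ℝ) (μ a : Measure (Eucl d)) : ℕ → Measure (Eucl d)
  | 0 => a
  | k + 1 => (euler A ε τ μ a k).map
      fun x => x + τ • velocity A ε μ (euler A ε τ μ a k) x

/-- The piecewise constant interpolation of the Euler scheme: it equals `α_k` at the times
`t ∈ [k τ, (k+1) τ)`. -/
def eulerCurve (A : Eucl d →L[ℝ] Eucl d) (ε τ : ℝ) (μ a : Measure (Eucl d)) (t : ℝ) :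
    Measure (Eucl d) :=
  euler A ε τ μ a ⌊t / τ⌋₊

/-- The empirical measure `(1/M) ∑ i, δ_{x i}`. -/
def empirical {M : ℕ} (x : Fin M → Eucl d) : Measure (Eucl d) :=
  (M : ℝ≥0∞)⁻¹ • ∑ i, Measure.dirac (x i)

/-- Continuity on `[0, T]`, for the distance `W₂`, of a curve of measures. -/
def W2ContinuousOn (T : ℝ) (α : ℝ → Measure (Eucl d)) : Prop :=
  ∀ t ∈ Set.Icc 0 T, Tendsto (fun s => W2 (α s) (α t)) (𝓝[Set.Icc 0 T] t) (𝓝 0)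

/-- Weak solutions on `[0, T] × ℝ^d` of
`∂_t α + div (α A (id - ∇ψ)) = 0`, `α(0, ·) = α₀`, `det (D²ψ_t) μ₀(∇ψ_t) = α_t`, `ψ_t` convex,
for data `α₀`, `μ₀` in `𝒫(B_{R₀})`. Only the values of `α` on `[0, T]` matter. -/
structure IsWeakSolution (A : Eucl d →L[ℝ] Eucl d) (R₀ T : ℝ) (α₀ μ₀ : Measure (Eucl d))
    (α : ℝ → Measure (Eucl d)) : Prop where
  continuous : W2ContinuousOn T α
  supported : ∀ t ∈ Set.Icc 0 T, α t ∈ probBall d (2 * R₀ * Real.exp (‖A‖ * T))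
  initial : α 0 = α₀
  /-- There is a measurable family `γ` of plans, `γ t` being an optimal plan between `α t` and `μ₀`
  for a.e. `t ∈ [0, T]`, for which the weak formulation holds against every `C¹` function `f` on
  `[0, T] × ℝ^d`. -/
  weak : ∃ γ : ℝ → Measure (Eucl d × Eucl d), Measurable γ ∧
    (∀ᵐ t ∂(volume.restrict (Set.Icc 0 T)), IsOptimalPlan (α t) μ₀ (γ t)) ∧
    ∀ f : ℝ → Eucl d → ℝ,
      ContDiffOn ℝ 1 (fun p : ℝ × Eucl d => f p.1 p.2) (Set.Icc 0 T ×ˢ Set.univ) →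
      (∫ t in (0 : ℝ)..T, ∫ x, (derivWithin (fun s => f s x) (Set.Icc 0 T) t
            + inner ℝ (A x) (gradient (f t) x)) ∂(α t))
        - (∫ t in (0 : ℝ)..T, ∫ p, inner ℝ (A p.2) (gradient (f t) p.1) ∂(γ t))
      = (∫ x, f T x ∂(α T)) - ∫ x, f 0 x ∂α₀

end SemiGeo

end

noncomputable section

namespace SemiGeo

open ProbabilityTheory InformationTheory

variable {d : ℕ}

/-! The velocity depends nonlinearly on the measure, and conditional means do not pass to weak
limits. Tested against a function, however, the velocity enters only as a conditional expectation:
`integral_velocity` replaces it by A(x - y), integrated against the entropic plan itself. The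
discrete equation is thus linear in the plans, and a weak limit of the plans suffices.

The entropic plans, constant on each time step, are combined with the uniform law on [0,T] into
joint laws of (t,x,y). Each Euler step multiplies the bound on ‖z‖ + R₀ at the atoms z by at most 1
+ τ‖A‖ (`exists_euler_eq_empirical`), so all these laws live on one compact set. Prokhorov's theorem
gives a limit law, and its disintegration in time is the required measurable family γ_t
(`exists_limit_kernel`). For a.e. t its marginals are α_t and μ₀, because the marginals of the
discrete plans converge at every t < T (`ae_map_eq_of_tendsto`).

Optimality rests on two facts. First, resampling the second coordinate of a near-optimal plan inside
cells of size δ gives a competitor whose entropy is bounded by the number of cells alone, so that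
OT_ε ≤ ½(W₂ + 2δ)² + ε(1 + number of cells) (`OTeps_le`). Letting ε → 0 and then δ → 0, the costs of
the discrete plans have limsup at most W₂²(α_t, μ₀) (`limsup_quadCost_le`). Second, joint
convergence controls the costs only on average in time, but the reverse Fatou lemma gives ∫
cost(γ_t) dt ≤ ∫ W₂²(α_t, μ₀) dt. As cost(γ_t) ≥ W₂²(α_t, μ₀) for a.e. t, equality holds a.e.
(`ae_quadCost_eq_W2sq`).

The scheme satisfies the weak formulation up to a Taylor error that vanishes with τ, uniformly on
the compact set (`abs_euler_weak_le`); the limit is taken in `weak_formulation_of_tendsto`. -/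

/-! ### Transport plans, gluing and the triangle inequality -/

theorem isProbabilityMeasure_of_mem_plans {α μ : Measure (Eucl d)} [IsProbabilityMeasure α]
    {γ : Measure (Eucl d × Eucl d)} (h : γ ∈ plans α μ) : IsProbabilityMeasure γ := by
  constructor
  have := measure_univ (μ := α)
  rwa [← h.1, Measure.fst_univ] at this

theorem quadCost_rpow_half (γ : Measure (Eucl d × Eucl d)) :
    quadCost γ ^ (1 / 2 : ℝ) = eLpNorm (fun p : Eucl d × Eucl d => p.1 - p.2) 2 γ := by
  rw [eLpNorm_eq_lintegral_rpow_enorm_toReal (by simp) (by simp), quadCost]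
  simp

theorem quadCost_eq_sq (γ : Measure (Eucl d × Eucl d)) :
    quadCost γ = (quadCost γ ^ (1 / 2 : ℝ)) ^ 2 := by
  rw [← ENNReal.rpow_natCast, ← ENNReal.rpow_mul]
  simp

theorem W2sq_eq_sq (α μ : Measure (Eucl d)) : W2sq α μ = W2 α μ ^ 2 := by
  rw [W2, ← ENNReal.rpow_natCast, ← ENNReal.rpow_mul]
  simp

theorem W2_le_of_mem_plans {α μ : Measure (Eucl d)} {γ : Measure (Eucl d × Eucl d)}
    (h : γ ∈ plans α μ) : W2 α μ ≤ quadCost γ ^ (1 / 2 : ℝ) :=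
  ENNReal.rpow_le_rpow (iInf₂_le γ h) (by norm_num)

theorem exists_mem_plans_lt {α μ : Measure (Eucl d)} {c : ℝ≥0∞} (h : W2 α μ < c) :
    ∃ γ ∈ plans α μ, quadCost γ ^ (1 / 2 : ℝ) < c := by
  have h2 : W2sq α μ < c ^ 2 := by
    rw [W2sq_eq_sq]
    gcongr
  obtain ⟨γ, hγ, hlt⟩ := by simpa only [W2sq, iInf_lt_iff, exists_prop] using h2
  refine ⟨γ, hγ, ?_⟩
  rw [quadCost_eq_sq] at hlt
  exact lt_of_pow_lt_pow_left' 2 hlt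

theorem swap_mem_plans {α μ : Measure (Eucl d)} {γ : Measure (Eucl d × Eucl d)}
    (h : γ ∈ plans α μ) : γ.map Prod.swap ∈ plans μ α := by
  refine ⟨?_, ?_⟩
  · rw [Measure.fst_map_swap, h.2]
  · rw [Measure.snd_map_swap, h.1]

theorem measurable_cost : Measurable (fun p : Eucl d × Eucl d => ‖p.1 - p.2‖ₑ ^ 2) := by
  fun_prop

theorem quadCost_map_swap (γ : Measure (Eucl d × Eucl d)) :
    quadCost (γ.map Prod.swap) = quadCost γ := by
  rw [quadCost, lintegral_map measurable_cost measurable_swap, quadCost]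
  congr with p
  rw [Prod.fst_swap, Prod.snd_swap, enorm_sub_rev]

theorem W2_comm (α μ : Measure (Eucl d)) : W2 α μ = W2 μ α := by
  have key (α μ : Measure (Eucl d)) : W2sq α μ ≤ W2sq μ α :=
    le_iInf₂ fun γ hγ => (iInf₂_le _ (swap_mem_plans hγ)).trans_eq (quadCost_map_swap γ)
  rw [W2, W2, le_antisymm (key α μ) (key μ α)]

/-- Transporting the second coordinate of a plan along a kernel. -/
def glue (γ : Measure (Eucl d × Eucl d)) (κ : Kernel (Eucl d) (Eucl d)) :
    Measure (Eucl d × Eucl d) :=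
  (γ ⊗ₘ κ.comap Prod.snd measurable_snd).map fun p => (p.1.1, p.2)

section glue

variable (γ : Measure (Eucl d × Eucl d)) [IsProbabilityMeasure γ]
  (κ : Kernel (Eucl d) (Eucl d)) [IsMarkovKernel κ]

theorem lintegral_glue {f : Eucl d × Eucl d → ℝ≥0∞} (hf : Measurable f) :
    ∫⁻ p, f p ∂(glue γ κ) = ∫⁻ p, ∫⁻ z, f (p.1, z) ∂(κ p.2) ∂γ := by
  rw [glue, lintegral_map hf (by fun_prop), Measure.lintegral_compProd (by fun_prop)]
  simp

theorem glue_fst : (glue γ κ).fst = γ.fst := by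
  ext s hs
  rw [Measure.fst_apply hs, ← lintegral_indicator_one (measurable_fst hs),
    lintegral_glue γ κ (measurable_one.indicator (measurable_fst hs)), Measure.fst_apply hs,
    ← lintegral_indicator_one (measurable_fst hs)]
  congr with p
  have : ∀ z, (Prod.fst ⁻¹' s).indicator (1 : Eucl d × Eucl d → ℝ≥0∞) (p.1, z)
      = (Prod.fst ⁻¹' s).indicator 1 p := fun z => rfl
  simp [this]

theorem glue_snd : (glue γ κ).snd = (γ.snd ⊗ₘ κ).snd := by
  ext s hs
  rw [Measure.snd_apply hs, ← lintegral_indicator_one (measurable_snd hs),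
    lintegral_glue γ κ (measurable_one.indicator (measurable_snd hs)), Measure.snd_apply hs,
    ← lintegral_indicator_one (measurable_snd hs),
    Measure.lintegral_compProd (measurable_one.indicator (measurable_snd hs)), Measure.snd,
    lintegral_map _ measurable_snd]
  · rfl
  · exact (measurable_one.indicator (measurable_snd hs)).lintegral_kernel_prod_right'

/-- Minkowski's inequality in L² of the law `Q` of a triple (x, y, z): the three costs are the
squared norms of x - z, x - y and y - z under `Q`. -/
theorem quadCost_glue_le :
    quadCost (glue γ κ) ^ (1 / 2 : ℝ)
      ≤ quadCost γ ^ (1 / 2 : ℝ) + quadCost (γ.snd ⊗ₘ κ) ^ (1 / 2 : ℝ) := by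
  set Q := γ ⊗ₘ κ.comap Prod.snd measurable_snd with hQ
  have h1 : quadCost (glue γ κ) ^ (1 / 2 : ℝ) = eLpNorm (fun p => p.1.1 - p.2) 2 Q := by
    rw [quadCost_rpow_half, glue, eLpNorm_map_measure (by fun_prop) (by fun_prop)]
    rfl
  have h2 : quadCost γ ^ (1 / 2 : ℝ) = eLpNorm (fun p => p.1.1 - p.1.2) 2 Q := by
    rw [quadCost_rpow_half, ← Measure.fst_compProd γ (κ.comap Prod.snd measurable_snd),
      Measure.fst, eLpNorm_map_measure (by fun_prop) (by fun_prop)]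
    rfl
  have h3 : quadCost (γ.snd ⊗ₘ κ) ^ (1 / 2 : ℝ) = eLpNorm (fun p => p.1.2 - p.2) 2 Q := by
    have : γ.snd ⊗ₘ κ = Q.map fun p => (p.1.2, p.2) := by
      ext s hs
      have hm : Measurable fun a : (Eucl d × Eucl d) × Eucl d =>
          s.indicator (1 : Eucl d × Eucl d → ℝ≥0∞) (a.1.2, a.2) :=
        (measurable_one.indicator hs).comp
          ((measurable_snd.comp measurable_fst).prodMk measurable_snd)
      rw [← lintegral_indicator_one hs, ← lintegral_indicator_one hs,
        lintegral_map (measurable_one.indicator hs) (by fun_prop), hQ,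
        Measure.lintegral_compProd (measurable_one.indicator hs),
        Measure.lintegral_compProd hm, Measure.snd, lintegral_map _ measurable_snd]
      · rfl
      · exact (measurable_one.indicator hs).lintegral_kernel_prod_right'
    rw [quadCost_rpow_half, this, eLpNorm_map_measure (by fun_prop) (by fun_prop)]
    rfl
  rw [h1, h2, h3]
  refine le_trans (le_of_eq ?_) (eLpNorm_add_le (by fun_prop) (by fun_prop) (by norm_num))
  congr with p
  simp

end glue

/-- Near-optimal plans are glued along their common marginal β, by disintegrating the second one. No
optimal plan is needed. -/
theorem W2_triangle (α β μ : Measure (Eucl d)) [IsProbabilityMeasure α] [IsProbabilityMeasure β] :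
    W2 α μ ≤ W2 α β + W2 β μ := by
  refine ENNReal.le_of_forall_pos_le_add fun η hη hfin => ?_
  have hη' : (η / 2 : ℝ≥0∞) ≠ 0 := by simpa using hη.ne'
  obtain ⟨hf1, hf2⟩ := ENNReal.add_lt_top.1 hfin
  obtain ⟨γ, hγ, hγc⟩ := exists_mem_plans_lt (ENNReal.lt_add_right hf1.ne hη')
  obtain ⟨π, hπ, hπc⟩ := exists_mem_plans_lt (ENNReal.lt_add_right hf2.ne hη')
  have := isProbabilityMeasure_of_mem_plans hγ
  have := isProbabilityMeasure_of_mem_plans hπ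
  have hdis : γ.snd ⊗ₘ π.condKernel = π := by
    rw [hγ.2, ← hπ.1, π.disintegrate]
  have hmem : glue γ π.condKernel ∈ plans α μ :=
    ⟨by rw [glue_fst, hγ.1], by rw [glue_snd, hdis, hπ.2]⟩
  calc W2 α μ ≤ _ := W2_le_of_mem_plans hmem
    _ ≤ _ := quadCost_glue_le γ π.condKernel
    _ ≤ (W2 α β + η / 2) + (W2 β μ + η / 2) := by
      rw [hdis]
      exact add_le_add hγc.le hπc.le
    _ = W2 α β + W2 β μ + η := by
      rw [add_add_add_comm, ENNReal.add_halves]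

/-! ### Block approximation and the upper bound for the entropic cost -/

/-- The kernel sending `y` to the normalized restriction of `μ` to the cell of `y`, for the
partition into the level sets of `q`. -/
def blockKernel (q : SimpleFunc (Eucl d) (Eucl d)) (μ : Measure (Eucl d)) :
    Kernel (Eucl d) (Eucl d) where
  toFun y := if μ (q ⁻¹' {q y}) = 0 then μ else μ[|q ⁻¹' {q y}]
  measurable' := (q.map fun c => if μ (q ⁻¹' {c}) = 0 then μ else μ[|q ⁻¹' {c}]).measurable

section block

variable (q : SimpleFunc (Eucl d) (Eucl d)) (μ : Measure (Eucl d))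

instance [IsProbabilityMeasure μ] : IsMarkovKernel (blockKernel q μ) where
  isProbabilityMeasure y := by
    change IsProbabilityMeasure (if μ (q ⁻¹' {q y}) = 0 then μ else μ[|q ⁻¹' {q y}])
    split_ifs with h
    · infer_instance
    · exact cond_isProbabilityMeasure h

/-- There are finitely many cells, so the union of the null ones is null. -/
theorem ae_measure_cell_ne_zero : ∀ᵐ y ∂μ, μ (q ⁻¹' {q y}) ≠ 0 := by
  have h : ∀ c ∈ q.range, ∀ᵐ y ∂μ, q y = c → μ (q ⁻¹' {c}) ≠ 0 := by
    intro c _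
    by_cases hc : μ (q ⁻¹' {c}) = 0
    · have : ∀ᵐ y ∂μ, y ∉ q ⁻¹' {c} := measure_eq_zero_iff_ae_notMem.1 hc
      filter_upwards [this] with y hy hyc
      exact absurd hyc hy
    · exact ae_of_all _ fun y _ => hc
  have := (Finset.eventually_all _).2 h
  filter_upwards [this] with y hy using hy (q y) (q.mem_range_self y) rfl

theorem blockKernel_apply {y : Eucl d} (h : μ (q ⁻¹' {q y}) ≠ 0) :
    blockKernel q μ y = μ[|q ⁻¹' {q y}] := if_neg h

/-- On the cell of y the density 1/μ(cell of y) equals 1/μ(cell of z). The resulting bound no longer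
involves y, which is what makes it integrable against any plan. -/
theorem blockKernel_le {y : Eucl d} (h : μ (q ⁻¹' {q y}) ≠ 0) :
    blockKernel q μ y ≤ μ.withDensity fun z => (μ (q ⁻¹' {q z}))⁻¹ := by
  rw [blockKernel_apply q μ h, ProbabilityTheory.cond]
  refine Measure.le_iff.2 fun s hs => ?_
  rw [Measure.smul_apply, Measure.restrict_apply hs, smul_eq_mul, withDensity_apply _ hs]
  calc _ = ∫⁻ z in s ∩ q ⁻¹' {q y}, (μ (q ⁻¹' {q y}))⁻¹ ∂μ := by simp
    _ = ∫⁻ z in s ∩ q ⁻¹' {q y}, (μ (q ⁻¹' {q z}))⁻¹ ∂μ := by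
      refine setLIntegral_congr_fun (hs.inter (q.measurableSet_fiber _)) fun z hz => ?_
      have : q z = q y := hz.2
      simp only [this]
    _ ≤ _ := lintegral_mono_set Set.inter_subset_left

theorem measurable_inv_cell : Measurable fun z => (μ (q ⁻¹' {q z}))⁻¹ :=
  (q.map fun c => (μ (q ⁻¹' {c}))⁻¹).measurable

/-- Each cell of positive mass contributes exactly 1. This is how the number of cells enters the
entropy bound. -/
theorem lintegral_inv_cell_le : ∫⁻ z, (μ (q ⁻¹' {q z}))⁻¹ ∂μ ≤ q.range.card := by
  have := (q.map fun c => (μ (q ⁻¹' {c}))⁻¹).lintegral_eq_lintegral μ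
  simp only [SimpleFunc.coe_map, Function.comp_def] at this
  rw [this, SimpleFunc.map_lintegral]
  refine (Finset.sum_le_card_nsmul _ _ 1 fun c _ => ?_).trans (by simp)
  exact ENNReal.inv_mul_le_one _

/-- Law of total probability: choosing a cell according to `μ` and then a point from `μ` conditioned
on it reproduces `μ`. -/
theorem snd_compProd_blockKernel [IsProbabilityMeasure μ] :
    (μ ⊗ₘ blockKernel q μ).snd = μ := by
  ext s hs
  rw [Measure.snd_apply hs, Measure.compProd_apply (measurable_snd hs)]
  have h1 : ∀ᵐ y ∂μ, blockKernel q μ y (Prod.mk y ⁻¹' (Prod.snd ⁻¹' s))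
      = (q.map fun c => (μ (q ⁻¹' {c}))⁻¹ * μ (q ⁻¹' {c} ∩ s)) y := by
    filter_upwards [ae_measure_cell_ne_zero q μ] with y hy
    rw [blockKernel_apply q μ hy, cond_apply (q.measurableSet_fiber _)]
    rfl
  rw [lintegral_congr_ae h1, SimpleFunc.lintegral_eq_lintegral, SimpleFunc.map_lintegral]
  have h2 : ∀ c ∈ q.range, (μ (q ⁻¹' {c}))⁻¹ * μ (q ⁻¹' {c} ∩ s) * μ (q ⁻¹' {c})
      = μ.restrict s (q ⁻¹' {c}) := by
    intro c _
    rw [Measure.restrict_apply (q.measurableSet_fiber _)]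
    by_cases hc : μ (q ⁻¹' {c}) = 0
    · rw [hc, measure_inter_null_of_null_left _ hc]
      simp
    · rw [mul_right_comm, ENNReal.inv_mul_cancel hc (measure_ne_top _ _), one_mul]
  rw [Finset.sum_congr rfl h2, SimpleFunc.sum_range_measure_preimage_singleton]
  simp

/-- Two points of one cell are both within δ of the same value of `q`, hence within 2δ of each
other. -/
theorem quadCost_blockKernel_le [IsProbabilityMeasure μ] {R δ : ℝ} (hμ : μ (Metric.closedBall 0 R)ᶜ = 0)
    (hq : ∀ y ∈ Metric.closedBall 0 R, dist (q y) y ≤ δ) :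
    quadCost (μ ⊗ₘ blockKernel q μ) ^ (1 / 2 : ℝ) ≤ ENNReal.ofReal (2 * δ) := by
  have hball : ∀ᵐ y ∂μ, y ∈ Metric.closedBall (0 : Eucl d) R := by
    rw [ae_iff]; exact hμ
  rw [quadCost, Measure.lintegral_compProd measurable_cost]
  have h1 : ∀ᵐ y ∂μ, ∫⁻ z, ‖y - z‖ₑ ^ 2 ∂(blockKernel q μ y) ≤ ENNReal.ofReal (2 * δ) ^ 2 := by
    filter_upwards [hball, ae_measure_cell_ne_zero q μ] with y hy hcell
    have h2 : ∀ᵐ z ∂(blockKernel q μ y), ‖y - z‖ₑ ^ 2 ≤ ENNReal.ofReal (2 * δ) ^ 2 := by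
      rw [blockKernel_apply q μ hcell]
      filter_upwards [(cond_absolutelyContinuous).ae_le hball,
        ae_cond_mem (q.measurableSet_fiber _)] with z hz hzc
      have hzc : q z = q y := hzc
      gcongr
      rw [← ofReal_norm]
      refine ENNReal.ofReal_le_ofReal ?_
      rw [← dist_eq_norm]
      have h3 := hq y hy
      have h4 := hq z hz
      rw [hzc] at h4
      linarith [dist_triangle_left y z (q y)]
    exact (lintegral_mono_ae h2).trans_eq (by simp)
  calc _ ≤ (∫⁻ _, ENNReal.ofReal (2 * δ) ^ 2 ∂μ) ^ (1 / 2 : ℝ) :=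
        ENNReal.rpow_le_rpow (lintegral_mono_ae h1) (by norm_num)
    _ = ENNReal.ofReal (2 * δ) := by
      rw [lintegral_const, measure_univ, mul_one, ← ENNReal.rpow_natCast, ← ENNReal.rpow_mul]
      simp

/-- The fibrewise density bound does not depend on the old second coordinate, so integrating over
`γ` keeps only its first marginal α and yields a bound relative to the product. -/
theorem glue_blockKernel_le [IsProbabilityMeasure μ] {α : Measure (Eucl d)} [IsProbabilityMeasure α]
    {γ : Measure (Eucl d × Eucl d)} (hγ : γ ∈ plans α μ) :
    glue γ (blockKernel q μ)
      ≤ (α.prod μ).withDensity fun p => (μ (q ⁻¹' {q p.2}))⁻¹ := by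
  have := isProbabilityMeasure_of_mem_plans hγ
  have hcell : ∀ᵐ p ∂γ, μ (q ⁻¹' {q p.2}) ≠ 0 := by
    have h := ae_measure_cell_ne_zero q μ
    rw [← hγ.2] at h
    rw [← hγ.2]
    exact ae_of_ae_map measurable_snd.aemeasurable h
  have hm := measurable_inv_cell q μ
  refine Measure.le_iff.2 fun s hs => ?_
  have hfin : SFinite (μ.withDensity fun z => (μ (q ⁻¹' {q z}))⁻¹) := inferInstance
  rw [← lintegral_indicator_one hs, lintegral_glue _ _ (measurable_one.indicator hs),
    ← prod_withDensity_right hm, Measure.prod_apply hs, ← hγ.1, Measure.fst,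
    lintegral_map (measurable_measure_prodMk_left hs) measurable_fst]
  refine lintegral_mono_ae ?_
  filter_upwards [hcell] with p hp
  have : (fun z => s.indicator (1 : Eucl d × Eucl d → ℝ≥0∞) (p.1, z))
      = (Prod.mk p.1 ⁻¹' s).indicator 1 := rfl
  rw [this, lintegral_indicator_one (measurable_prodMk_left hs)]
  exact blockKernel_le q μ hp _

end block

theorem klFun_le_one_add_sq {x : ℝ} (hx : 0 ≤ x) : klFun x ≤ 1 + x * x := by
  rw [klFun_apply]
  nlinarith [mul_le_mul_of_nonneg_left (Real.log_le_self hx) hx]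

/-- With r = dP/dν ≤ w and klFun r ≤ 1 + r², the entropy is at most 1 + ∫ r w dν = 1 + ∫ w dP. The
logarithm is given away, which is harmless because the entropy is later multiplied by ε → 0. -/
theorem klDiv_le_of_le_withDensity {Ω : Type*} [MeasurableSpace Ω] {P ν : Measure Ω}
    [IsProbabilityMeasure P] [IsProbabilityMeasure ν] {w : Ω → ℝ≥0∞} (hw : Measurable w)
    (h : P ≤ ν.withDensity w) : klDiv P ν ≤ 1 + ∫⁻ p, w p ∂P := by
  have hac : P ≪ ν :=
    (Measure.absolutelyContinuous_of_le h).trans (withDensity_absolutelyContinuous ν w)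
  have hr : P.rnDeriv ν ≤ᵐ[ν] w := by
    refine ae_le_of_forall_setLIntegral_le_of_sigmaFinite (Measure.measurable_rnDeriv P ν)
      fun s hs _ => ?_
    calc _ ≤ P s := Measure.setLIntegral_rnDeriv_le s
      _ ≤ ν.withDensity w s := h s
      _ = _ := withDensity_apply _ hs
  rw [klDiv_eq_lintegral_klFun_of_ac hac]
  calc _ ≤ ∫⁻ p, (1 + P.rnDeriv ν p * w p) ∂ν := by
        refine lintegral_mono_ae ?_
        filter_upwards [hr, P.rnDeriv_lt_top ν] with p hp hp'
        refine (ENNReal.ofReal_le_ofReal (klFun_le_one_add_sq ENNReal.toReal_nonneg)).trans ?_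
        rw [ENNReal.ofReal_add zero_le_one (by positivity), ENNReal.ofReal_one,
          ENNReal.ofReal_mul ENNReal.toReal_nonneg, ENNReal.ofReal_toReal hp'.ne]
        gcongr
    _ = 1 + ∫⁻ p, w p ∂P := by
        rw [lintegral_add_left measurable_const, lintegral_const, measure_univ, mul_one,
          lintegral_rnDeriv_mul hac hw.aemeasurable]

/-- The entropic transport cost exceeds half the squared Wasserstein distance by a quantity that
only depends on `ε` and on a partition of the ball into small cells. -/
theorem OTeps_le {α μ : Measure (Eucl d)} [IsProbabilityMeasure α] [IsProbabilityMeasure μ]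
    {R δ : ℝ} (hμ : μ (Metric.closedBall 0 R)ᶜ = 0) (q : SimpleFunc (Eucl d) (Eucl d))
    (hq : ∀ y ∈ Metric.closedBall 0 R, dist (q y) y ≤ δ) (ε : ℝ) :
    OTeps ε α μ ≤ 2⁻¹ * (W2 α μ + ENNReal.ofReal (2 * δ)) ^ 2
      + ENNReal.ofReal ε * (1 + q.range.card) := by
  by_cases hfin : W2 α μ = ∞
  · simp [hfin]
  -- A level c strictly above W₂ supplies a plan without an existence theorem; the bound is
  -- continuous in c, and c decreases to W₂ at the end.
  have key : ∀ c : ℝ≥0∞, W2 α μ < c → OTeps ε α μ ≤ 2⁻¹ * (c + ENNReal.ofReal (2 * δ)) ^ 2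
      + ENNReal.ofReal ε * (1 + q.range.card) := by
    intro c hc
    obtain ⟨γ, hγ, hγc⟩ := exists_mem_plans_lt hc
    have := isProbabilityMeasure_of_mem_plans hγ
    set γ' := glue γ (blockKernel q μ)
    have hmem : γ' ∈ plans α μ :=
      ⟨by rw [glue_fst, hγ.1], by rw [glue_snd, hγ.2, snd_compProd_blockKernel]⟩
    have := isProbabilityMeasure_of_mem_plans hmem
    refine (iInf₂_le γ' hmem).trans ?_
    rw [entropicCost]
    refine add_le_add (mul_le_mul_right ?_ _) (mul_le_mul_right ?_ _)
    · rw [quadCost_eq_sq]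
      gcongr
      refine (quadCost_glue_le γ _).trans (add_le_add hγc.le ?_)
      rw [hγ.2]
      exact quadCost_blockKernel_le q μ hμ hq
    · have hm := measurable_inv_cell q μ
      refine (klDiv_le_of_le_withDensity (hm.comp measurable_snd)
        (glue_blockKernel_le q μ hγ)).trans ?_
      gcongr
      refine le_trans (le_of_eq ?_) (lintegral_inv_cell_le q μ)
      refine (lintegral_map hm measurable_snd).symm.trans ?_
      exact congrArg (fun m => ∫⁻ z, (μ (q ⁻¹' {q z}))⁻¹ ∂m) hmem.2
  have hcont : Tendsto (fun c : ℝ≥0∞ => 2⁻¹ * (c + ENNReal.ofReal (2 * δ)) ^ 2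
      + ENNReal.ofReal ε * (1 + q.range.card)) (𝓝[>] (W2 α μ))
      (𝓝 (2⁻¹ * (W2 α μ + ENNReal.ofReal (2 * δ)) ^ 2
      + ENNReal.ofReal ε * (1 + q.range.card))) := by
    have : Continuous fun c : ℝ≥0∞ => 2⁻¹ * (c + ENNReal.ofReal (2 * δ)) ^ 2
        + ENNReal.ofReal ε * (1 + q.range.card) :=
      ((ENNReal.continuous_const_mul (by simp)).comp
        ((ENNReal.continuous_pow 2).comp (continuous_id.add continuous_const))).add
        continuous_const
    exact this.continuousAt.tendsto.mono_left nhdsWithin_le_nhds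
  have : (𝓝[>] (W2 α μ)).NeBot := nhdsGT_neBot_of_exists_gt ⟨∞, Ne.lt_top hfin⟩
  exact ge_of_tendsto hcont (eventually_mem_nhdsWithin.mono fun c hc => key c hc)

theorem exists_simpleFunc_dist_le (d : ℕ) (R : ℝ) {δ : ℝ} (hδ : 0 < δ) :
    ∃ q : SimpleFunc (Eucl d) (Eucl d), ∀ y ∈ Metric.closedBall 0 R, dist (q y) y ≤ δ := by
  obtain ⟨t, -, htf, ht⟩ :=
    finite_cover_balls_of_compact (isCompact_closedBall (0 : Eucl d) R) hδ
  obtain ⟨n, e, he⟩ := htf.fin_param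
  -- An empty net means that the ball is empty (R < 0), and the claim is vacuous.
  by_cases hn : n = 0
  · subst hn
    refine ⟨0, fun y hy => ?_⟩
    obtain ⟨i, hi, -⟩ := Set.mem_iUnion₂.1 (ht hy)
    rw [← he.2] at hi
    obtain ⟨j, -⟩ := hi
    exact j.elim0
  · let e' : ℕ → Eucl d := fun k => if h : k < n then e ⟨k, h⟩ else 0
    refine ⟨SimpleFunc.nearestPt e' n, fun y hy => ?_⟩
    obtain ⟨i, hi, hiy⟩ := Set.mem_iUnion₂.1 (ht hy)
    rw [← he.2] at hi
    obtain ⟨j, rfl⟩ := hi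
    have h1 := SimpleFunc.edist_nearestPt_le e' y j.2.le
    have h2 : e' j = e j := by simp [e']
    rw [h2] at h1
    have h3 : dist (SimpleFunc.nearestPt e' n y) y ≤ dist (e j) y := by
      rw [edist_dist, edist_dist] at h1
      exact (ENNReal.ofReal_le_ofReal_iff dist_nonneg).1 h1
    refine h3.trans ?_
    rw [dist_comm]
    exact le_of_lt hiy

/-! ### Existence of entropic plans between finitely supported measures -/

theorem prod_mem_plans (α μ : Measure (Eucl d)) [IsProbabilityMeasure α]
    [IsProbabilityMeasure μ] : α.prod μ ∈ plans α μ :=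
  ⟨Measure.fst_prod, Measure.snd_prod⟩

theorem ae_fst_of_mem_plans {α μ : Measure (Eucl d)} {γ : Measure (Eucl d × Eucl d)}
    (hγ : γ ∈ plans α μ) {p : Eucl d → Prop} (h : ∀ᵐ x ∂α, p x) : ∀ᵐ z ∂γ, p z.1 := by
  rw [← hγ.1] at h
  exact ae_of_ae_map measurable_fst.aemeasurable h

theorem ae_snd_of_mem_plans {α μ : Measure (Eucl d)} {γ : Measure (Eucl d × Eucl d)}
    (hγ : γ ∈ plans α μ) {p : Eucl d → Prop} (h : ∀ᵐ x ∂μ, p x) : ∀ᵐ z ∂γ, p z.2 := by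
  rw [← hγ.2] at h
  exact ae_of_ae_map measurable_snd.aemeasurable h

section atomic

variable {Ω : Type*} [MeasurableSpace Ω] [MeasurableSingletonClass Ω]

/-- The measure with atoms of mass `w p` at the points `p` of a finite set. -/
def atomic (t : Finset Ω) (w : t → ℝ≥0∞) : Measure Ω := ∑ p : t, w p • Measure.dirac (p : Ω)

theorem eq_atomic {t : Finset Ω} {γ : Measure Ω} (h : γ (t : Set Ω)ᶜ = 0) :
    γ = atomic t fun p => γ {(p : Ω)} := by
  have h1 : γ = γ.restrict t := (Measure.restrict_eq_self_of_ae_mem (by rwa [ae_iff])).symm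
  ext s hs
  conv_lhs => rw [h1, Measure.restrict_apply hs]
  have h2 : s ∩ t = ⋃ p ∈ t, s ∩ {p} := by
    ext x
    simp
  rw [h2, measure_biUnion_finset]
  · rw [atomic, Measure.finsetSum_apply, ← Finset.sum_coe_sort]
    refine Finset.sum_congr rfl fun p _ => ?_
    rw [Measure.smul_apply, Measure.dirac_apply' _ hs, smul_eq_mul]
    by_cases hp : (p : Ω) ∈ s
    · rw [Set.inter_eq_right.2 (by simpa using hp)]
      simp [hp]
    · rw [Set.inter_singleton_eq_empty.2 hp]
      simp [hp]
  · intro p _ q _ hpq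
    exact Set.disjoint_left.2 fun x hx hy => hpq (hx.2.symm.trans hy.2)
  · exact fun p _ => hs.inter (measurableSet_singleton p)

omit [MeasurableSingletonClass Ω] in
theorem atomic_apply (t : Finset Ω) (w : t → ℝ≥0∞) {s : Set Ω} (hs : MeasurableSet s) :
    atomic t w s = ∑ p : t, w p * s.indicator 1 (p : Ω) := by
  simp [atomic, Measure.finsetSum_apply, Measure.dirac_apply' _ hs]

theorem lintegral_atomic (t : Finset Ω) (w : t → ℝ≥0∞) (f : Ω → ℝ≥0∞) :
    ∫⁻ x, f x ∂(atomic t w) = ∑ p : t, w p * f p := by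
  simp [atomic, lintegral_finsetSum_measure]

theorem atomic_eq_withDensity {t : Finset Ω} {w v : t → ℝ≥0∞} (hv0 : ∀ p, v p ≠ 0)
    (hv : ∀ p, v p ≠ ∞) :
    ∃ g : Ω → ℝ≥0∞, Measurable g ∧ (∀ p : t, g p = w p / v p) ∧
      atomic t w = (atomic t v).withDensity g := by
  classical
  let g : Ω → ℝ≥0∞ := fun x => ∑ p : t, ({(p : Ω)} : Set Ω).indicator (fun _ => w p / v p) x
  have hg : Measurable g :=
    Finset.measurable_fun_sum _ fun p _ => measurable_const.indicator (measurableSet_singleton _)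
  have hgp : ∀ p : t, g p = w p / v p := by
    intro p
    simp only [g]
    rw [Finset.sum_eq_single p]
    · simp
    · intro q _ hqp
      exact Set.indicator_of_notMem (fun h => hqp (Subtype.ext (Set.mem_singleton_iff.1 h).symm)) _
    · simp
  refine ⟨g, hg, hgp, ?_⟩
  ext s hs
  rw [withDensity_apply _ hs, ← lintegral_indicator hs, lintegral_atomic, atomic_apply _ _ hs]
  refine Finset.sum_congr rfl fun p _ => ?_
  by_cases hp : (p : Ω) ∈ s
  · rw [Set.indicator_of_mem hp, Set.indicator_of_mem hp, hgp,
      ENNReal.mul_div_cancel (hv0 p) (hv p)]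
    simp
  · simp [hp]

/-- Positive reference weights make absolute continuity automatic, so the entropy is a finite sum
depending continuously on finite weights. -/
theorem klDiv_atomic {t : Finset Ω} {w v : t → ℝ≥0∞} [IsFiniteMeasure (atomic t w)]
    [IsFiniteMeasure (atomic t v)] (hv0 : ∀ p, v p ≠ 0) (hv : ∀ p, v p ≠ ∞) :
    klDiv (atomic t w) (atomic t v)
      = ∑ p : t, v p * ENNReal.ofReal (klFun (w p / v p).toReal) := by
  obtain ⟨g, hg, hgp, hwg⟩ := atomic_eq_withDensity (w := w) hv0 hv
  have hac : atomic t w ≪ atomic t v := by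
    rw [hwg]
    exact withDensity_absolutelyContinuous _ _
  rw [klDiv_eq_lintegral_klFun_of_ac hac]
  have h1 : (atomic t w).rnDeriv (atomic t v) =ᵐ[atomic t v] g := by
    rw [hwg]
    exact Measure.rnDeriv_withDensity _ hg
  have h2 : ∫⁻ x, ENNReal.ofReal (klFun ((atomic t w).rnDeriv (atomic t v) x).toReal) ∂(atomic t v)
      = ∫⁻ x, ENNReal.ofReal (klFun (g x).toReal) ∂(atomic t v) := by
    refine lintegral_congr_ae ?_
    filter_upwards [h1] with x hx
    rw [hx]
  rw [h2, lintegral_atomic]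
  simp only [hgp]

end atomic

/-- `entropicPlan` is an epsilon choice, so existence is what gives it content; uniqueness plays no
role. Every plan lives on the finite grid `s ×ˢ s'`, and the problem becomes the minimization of a
continuous function of the weights over a compact set. -/
theorem exists_isEntropicPlan (ε : ℝ) {α μ : Measure (Eucl d)} [IsProbabilityMeasure α]
    [IsProbabilityMeasure μ] {s s' : Finset (Eucl d)} (hα : α (s : Set (Eucl d))ᶜ = 0)
    (hα' : ∀ a ∈ s, α {a} ≠ 0) (hμ : μ (s' : Set (Eucl d))ᶜ = 0) (hμ' : ∀ a ∈ s', μ {a} ≠ 0) :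
    ∃ γ : ProbabilityMeasure (Eucl d × Eucl d),
      IsEntropicPlan ε α μ (γ : Measure (Eucl d × Eucl d)) := by
  classical
  set t : Finset (Eucl d × Eucl d) := s ×ˢ s' with ht
  have hplan : ∀ γ ∈ plans α μ, γ (t : Set (Eucl d × Eucl d))ᶜ = 0 := by
    intro γ hγ
    have h1 : ∀ᵐ x ∂α, x ∈ s := by rw [ae_iff]; exact hα
    have h2 : ∀ᵐ x ∂μ, x ∈ s' := by rw [ae_iff]; exact hμ
    have : ∀ᵐ z ∂γ, z ∈ t := by
      filter_upwards [ae_fst_of_mem_plans hγ h1, ae_snd_of_mem_plans hγ h2] with z h3 h4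
      exact Finset.mem_product.2 ⟨h3, h4⟩
    rwa [ae_iff] at this
  set v : t → ℝ≥0∞ := fun p => α.prod μ {(p : Eucl d × Eucl d)} with hv
  have hprod : α.prod μ = atomic t v := eq_atomic (hplan _ (prod_mem_plans α μ))
  have hv0 : ∀ p, v p ≠ 0 := by
    intro p
    have hp := Finset.mem_product.1 p.2
    have : v p = α {(p : Eucl d × Eucl d).1} * μ {(p : Eucl d × Eucl d).2} := by
      rw [hv, ← Measure.prod_prod]
      simp
    rw [this]
    exact mul_ne_zero (hα' _ hp.1) (hμ' _ hp.2)
  have hvt : ∀ p, v p ≠ ∞ := fun p => measure_ne_top _ _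
  set W : Set (t → ℝ≥0∞) := {w | atomic t w ∈ plans α μ} with hW
  have hWprob : ∀ w ∈ W, IsProbabilityMeasure (atomic t w) := fun w hw =>
    isProbabilityMeasure_of_mem_plans hw
  have hWtop : ∀ w ∈ W, ∀ p, w p ≠ ∞ := by
    intro w hw p hp
    have := hWprob w hw
    have h1 : w p ≤ atomic t w {(p : Eucl d × Eucl d)} := by
      rw [atomic_apply _ _ (measurableSet_singleton _)]
      refine le_trans (by simp) (Finset.single_le_sum (fun _ _ => zero_le) (Finset.mem_univ p))
    exact measure_ne_top (atomic t w) _ (top_le_iff.1 (hp ▸ h1))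
  have hcont : ∀ A : Set (Eucl d × Eucl d), MeasurableSet A → Continuous fun w => atomic t w A := by
    intro A hA
    simp only [atomic_apply _ _ hA]
    refine continuous_finsetSum _ fun p _ => ?_
    refine (ENNReal.continuous_mul_const ?_).comp (continuous_apply p)
    by_cases hp : (p : Eucl d × Eucl d) ∈ A <;> simp [hp]
  -- Closedness is enough for compactness, since the weights range over the compact space [0,∞]^t.
  -- Infinite weights are excluded because plans have total mass 1.
  have hWclosed : IsClosed W := by
    have : W = ⋂ A : {A : Set (Eucl d) // MeasurableSet A},
        ({w | atomic t w (Prod.fst ⁻¹' A) = α A} ∩ {w | atomic t w (Prod.snd ⁻¹' A) = μ A}) := by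
      ext w
      simp only [hW, plans, Set.mem_ofPred_eq, Set.mem_iInter, Set.mem_inter_iff, Subtype.forall]
      constructor
      · rintro ⟨h1, h2⟩ A hA
        rw [← Measure.fst_apply hA, ← Measure.snd_apply hA, h1, h2]
        exact ⟨rfl, rfl⟩
      · intro h
        refine ⟨Measure.ext fun A hA => ?_, Measure.ext fun A hA => ?_⟩
        · rw [Measure.fst_apply hA, (h A hA).1]
        · rw [Measure.snd_apply hA, (h A hA).2]
    rw [this]
    refine isClosed_iInter fun A => IsClosed.inter ?_ ?_
    · exact isClosed_eq (hcont _ (measurable_fst A.2)) continuous_const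
    · exact isClosed_eq (hcont _ (measurable_snd A.2)) continuous_const
  have hWne : W.Nonempty := ⟨v, by
    change atomic t v ∈ plans α μ
    rw [← hprod]
    exact prod_mem_plans α μ⟩
  have hF : ContinuousOn (fun w => entropicCost ε α μ (atomic t w)) W := by
    have h1 : ∀ w ∈ W, entropicCost ε α μ (atomic t w)
        = 2⁻¹ * (∑ p : t, w p * ‖(p : Eucl d × Eucl d).1 - (p : Eucl d × Eucl d).2‖ₑ ^ 2)
          + ENNReal.ofReal ε * ∑ p : t, v p * ENNReal.ofReal (klFun (w p / v p).toReal) := by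
      intro w hw
      have := hWprob w hw
      have : IsFiniteMeasure (atomic t v) := by rw [← hprod]; infer_instance
      rw [entropicCost, quadCost, lintegral_atomic, hprod, klDiv_atomic hv0 hvt]
    refine ContinuousOn.congr ?_ h1
    refine ContinuousOn.add ?_ ?_
    · refine Continuous.continuousOn ?_
      refine (ENNReal.continuous_const_mul (by simp)).comp (continuous_finsetSum _ fun p _ => ?_)
      exact (ENNReal.continuous_mul_const (by simp)).comp (continuous_apply p)
    · refine (ENNReal.continuous_const_mul (by simp)).comp_continuousOn ?_
      refine continuousOn_finsetSum _ fun p _ => ?_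
      refine (ENNReal.continuous_const_mul (hvt p)).comp_continuousOn ?_
      refine ENNReal.continuous_ofReal.comp_continuousOn (continuous_klFun.comp_continuousOn ?_)
      refine ENNReal.continuousOn_toReal.comp ?_ ?_
      · exact ((ENNReal.continuous_div_const _ (hv0 p)).comp (continuous_apply p)).continuousOn
      · intro w hw
        exact ENNReal.div_ne_top (hWtop w hw p) (hv0 p)
  obtain ⟨w, hw, hmin⟩ := hWclosed.isCompact.exists_isMinOn hWne hF
  refine ⟨⟨atomic t w, hWprob w hw⟩, hw, le_antisymm ?_ (iInf₂_le (atomic t w) hw)⟩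
  refine le_iInf₂ fun γ hγ => ?_
  have h1 := eq_atomic (hplan γ hγ)
  have h2 : (fun p : t => γ {(p : Eucl d × Eucl d)}) ∈ W := by
    change atomic t _ ∈ plans α μ
    rwa [← h1]
  have h3 := hmin h2
  simp only [Set.mem_ofPred_eq] at h3
  rwa [← h1] at h3

theorem entropicPlan_spec (ε : ℝ) {α μ : Measure (Eucl d)} [IsProbabilityMeasure α]
    [IsProbabilityMeasure μ] {s s' : Finset (Eucl d)} (hα : α (s : Set (Eucl d))ᶜ = 0)
    (hα' : ∀ a ∈ s, α {a} ≠ 0) (hμ : μ (s' : Set (Eucl d))ᶜ = 0) (hμ' : ∀ a ∈ s', μ {a} ≠ 0) :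
    IsEntropicPlan ε α μ (entropicPlan ε α μ : Measure (Eucl d × Eucl d)) :=
  Classical.epsilon_spec (exists_isEntropicPlan ε hα hα' hμ hμ')

/-! ### Empirical measures -/

section empirical

variable {M : ℕ} (x : Fin M → Eucl d)

theorem empirical_apply {s : Set (Eucl d)} (hs : MeasurableSet s) :
    empirical x s = (M : ℝ≥0∞)⁻¹ * ∑ i, s.indicator 1 (x i) := by
  simp [empirical, Measure.finsetSum_apply, Measure.dirac_apply' _ hs]

theorem isProbabilityMeasure_empirical (hM : 0 < M) : IsProbabilityMeasure (empirical x) := by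
  constructor
  rw [empirical_apply x MeasurableSet.univ]
  simp only [Set.indicator_univ, Pi.one_apply, Finset.sum_const, Finset.card_univ, Fintype.card_fin,
    nsmul_eq_mul, mul_one]
  exact ENNReal.inv_mul_cancel (by simpa using hM.ne') (by simp)

theorem empirical_eq_zero_of_forall_notMem {s : Set (Eucl d)} (hs : MeasurableSet s)
    (h : ∀ i, x i ∉ s) : empirical x s = 0 := by
  rw [empirical_apply x hs]
  simp [h]

theorem empirical_singleton_ne_zero (i : Fin M) : empirical x {x i} ≠ 0 := by
  rw [empirical_apply x (measurableSet_singleton _)]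
  refine mul_ne_zero (by simp) fun h => ?_
  have := Finset.sum_eq_zero_iff.1 h i (Finset.mem_univ i)
  simp at this

theorem map_empirical {f : Eucl d → Eucl d} (hf : Measurable f) :
    (empirical x).map f = empirical (f ∘ x) := by
  ext s hs
  rw [Measure.map_apply hf hs, empirical_apply _ (hf hs), empirical_apply _ hs]
  rfl

theorem entropicPlan_empirical_spec (ε : ℝ) (y : Fin M → Eucl d) (hM : 0 < M) :
    IsEntropicPlan ε (empirical x) (empirical y)
      (entropicPlan ε (empirical x) (empirical y) : Measure (Eucl d × Eucl d)) := by
  classical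
  have := isProbabilityMeasure_empirical x hM
  have := isProbabilityMeasure_empirical y hM
  have key : ∀ z : Fin M → Eucl d,
      empirical z ((Finset.univ.image z : Finset (Eucl d)) : Set (Eucl d))ᶜ = 0 ∧
      ∀ a ∈ Finset.univ.image z, empirical z {a} ≠ 0 := by
    intro z
    refine ⟨empirical_eq_zero_of_forall_notMem z (Finset.measurableSet _).compl (by simp), ?_⟩
    simp only [Finset.mem_image, Finset.mem_univ, true_and, forall_exists_index,
      forall_apply_eq_imp_iff]
    exact empirical_singleton_ne_zero z
  exact entropicPlan_spec ε (key x).1 (key x).2 (key y).1 (key y).2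

end empirical

/-! ### Consequences of W₂ convergence: integrals, supports, measurability -/

theorem integrable_of_continuousOn {Ω : Type*} [MeasurableSpace Ω] [TopologicalSpace Ω]
    [T2Space Ω] [OpensMeasurableSpace Ω] {F : Type*} [NormedAddCommGroup F] {P : Measure Ω}
    [IsFiniteMeasure P] {K : Set Ω} (hK : IsCompact K) (hP : P Kᶜ = 0) {f : Ω → F}
    [SecondCountableTopologyEither Ω F] [TopologicalSpace.PseudoMetrizableSpace Ω]
    (hf : ContinuousOn f K) : Integrable f P := by
  have h := hf.integrableOn_compact hK (μ := P)
  rwa [IntegrableOn, Measure.restrict_eq_self_of_ae_mem] at h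
  rwa [ae_iff]

/-- Integrals of a function that is continuous on a compact set carrying the measures are uniformly
continuous with respect to the Wasserstein distance. -/
theorem exists_forall_W2_lt_integral_sub_le {K : Set (Eucl d)} (hK : IsCompact K)
    {f : Eucl d → ℝ} (hf : ContinuousOn f K) {η : ℝ} (hη : 0 < η) :
    ∃ δ : ℝ, 0 < δ ∧ ∀ α β : Measure (Eucl d), IsProbabilityMeasure α → IsProbabilityMeasure β →
      α Kᶜ = 0 → β Kᶜ = 0 → W2 α β < ENNReal.ofReal δ →
      |∫ x, f x ∂α - ∫ x, f x ∂β| ≤ η := by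
  obtain ⟨B, hB⟩ := hK.exists_bound_of_continuousOn hf
  obtain ⟨r, hr, hfr⟩ := Metric.uniformContinuousOn_iff_le.1
    (hK.uniformContinuousOn_of_continuous hf) (η / 2) (by positivity)
  -- For points of K more than r apart, |f(x) - f(y)| ≤ 2|B| ≤ C|x - y|²; closer points cost at most
  -- η/2. The choice Cδ² = η/2 balances the two, and the added 1 keeps C positive.
  set C : ℝ := 2 * |B| / r ^ 2 + 1 with hC
  have hCpos : 0 < C := by positivity
  set δ : ℝ := Real.sqrt (η / 2 / C) with hδ
  have hδ2 : C * δ ^ 2 = η / 2 := by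
    rw [hδ, Real.sq_sqrt (by positivity)]
    field_simp
  refine ⟨δ, by positivity, fun α β _ _ hα hβ hW => ?_⟩
  obtain ⟨γ, hγ, hγc⟩ := exists_mem_plans_lt hW
  have := isProbabilityMeasure_of_mem_plans hγ
  have hfα := integrable_of_continuousOn hK hα hf
  have hfβ := integrable_of_continuousOn hK hβ hf
  have h1 : ∫ x, f x ∂α = ∫ p, f p.1 ∂γ := by
    rw [← hγ.1, Measure.fst, integral_map measurable_fst.aemeasurable]
    rw [← Measure.fst, hγ.1]
    exact hfα.aestronglyMeasurable
  have h2 : ∫ x, f x ∂β = ∫ p, f p.2 ∂γ := by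
    rw [← hγ.2, Measure.snd, integral_map measurable_snd.aemeasurable]
    rw [← Measure.snd, hγ.2]
    exact hfβ.aestronglyMeasurable
  have i1 : Integrable (fun p : Eucl d × Eucl d => f p.1) γ := by
    rw [← hγ.1] at hfα
    exact hfα.comp_measurable measurable_fst
  have i2 : Integrable (fun p : Eucl d × Eucl d => f p.2) γ := by
    rw [← hγ.2] at hfβ
    exact hfβ.comp_measurable measurable_snd
  rw [h1, h2, ← integral_sub i1 i2]
  have hae : ∀ᵐ p ∂γ, ‖f p.1 - f p.2‖ₑ
      ≤ ENNReal.ofReal (η / 2) + ENNReal.ofReal C * ‖p.1 - p.2‖ₑ ^ 2 := by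
    have ha : ∀ᵐ x ∂α, x ∈ K := by rw [ae_iff]; exact hα
    have hb : ∀ᵐ x ∂β, x ∈ K := by rw [ae_iff]; exact hβ
    filter_upwards [ae_fst_of_mem_plans hγ ha, ae_snd_of_mem_plans hγ hb] with p hp1 hp2
    rw [← ofReal_norm, ← ofReal_norm, ← ENNReal.ofReal_pow (norm_nonneg _),
      ← ENNReal.ofReal_mul hCpos.le, ← ENNReal.ofReal_add (by positivity) (by positivity)]
    refine ENNReal.ofReal_le_ofReal ?_
    by_cases hd : dist p.1 p.2 ≤ r
    · have := hfr _ hp1 _ hp2 hd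
      rw [Real.dist_eq, ← Real.norm_eq_abs] at this
      have h0 : 0 ≤ C * ‖p.1 - p.2‖ ^ 2 := by positivity
      linarith
    · rw [dist_eq_norm, not_le] at hd
      have h3 : ‖f p.1 - f p.2‖ ≤ 2 * |B| := by
        have := norm_sub_le (f p.1) (f p.2)
        have := hB _ hp1
        have := hB _ hp2
        have := le_abs_self B
        linarith
      have h4 : 2 * |B| ≤ C * ‖p.1 - p.2‖ ^ 2 := by
        have h5 : r ^ 2 ≤ ‖p.1 - p.2‖ ^ 2 := by gcongr
        calc 2 * |B| = 2 * |B| / r ^ 2 * r ^ 2 := by field_simp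
          _ ≤ C * r ^ 2 := by gcongr; linarith
          _ ≤ _ := by gcongr
      linarith
  have hq : quadCost γ ≤ ENNReal.ofReal (δ ^ 2) := by
    rw [quadCost_eq_sq, ENNReal.ofReal_pow (by positivity)]
    gcongr
  have hfinal : ‖∫ p, (f p.1 - f p.2) ∂γ‖ₑ ≤ ENNReal.ofReal η := by
    calc _ ≤ ∫⁻ p, ‖f p.1 - f p.2‖ₑ ∂γ := enorm_integral_le_lintegral_enorm _
      _ ≤ ∫⁻ p, (ENNReal.ofReal (η / 2) + ENNReal.ofReal C * ‖p.1 - p.2‖ₑ ^ 2) ∂γ :=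
        lintegral_mono_ae hae
      _ = ENNReal.ofReal (η / 2) + ENNReal.ofReal C * quadCost γ := by
        rw [lintegral_add_left measurable_const, lintegral_const, measure_univ, mul_one,
          lintegral_const_mul _ measurable_cost, quadCost]
      _ ≤ ENNReal.ofReal (η / 2) + ENNReal.ofReal C * ENNReal.ofReal (δ ^ 2) := by gcongr
      _ = ENNReal.ofReal η := by
        rw [← ENNReal.ofReal_mul hCpos.le, hδ2, ← ENNReal.ofReal_add (by positivity)
          (by positivity), add_halves]
  rw [← ofReal_norm, Real.norm_eq_abs, ENNReal.ofReal_le_ofReal_iff hη.le] at hfinal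
  exact hfinal

theorem tendsto_integral_of_tendsto_W2 {K : Set (Eucl d)} (hK : IsCompact K) {f : Eucl d → ℝ}
    (hf : ContinuousOn f K) {ι : Type*} {l : Filter ι} {α : ι → Measure (Eucl d)}
    {β : Measure (Eucl d)} (hα : ∀ᶠ i in l, IsProbabilityMeasure (α i) ∧ α i Kᶜ = 0)
    [IsProbabilityMeasure β] (hβ : β Kᶜ = 0) (h : Tendsto (fun i => W2 (α i) β) l (𝓝 0)) :
    Tendsto (fun i => ∫ x, f x ∂(α i)) l (𝓝 (∫ x, f x ∂β)) := by
  rw [Metric.tendsto_nhds]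
  intro η hη
  obtain ⟨δ, hδ, hδη⟩ := exists_forall_W2_lt_integral_sub_le hK hf (half_pos hη)
  filter_upwards [hα, h.eventually (gt_mem_nhds (ENNReal.ofReal_pos.2 hδ))] with i hi hi'
  have := hδη (α i) β hi.1 inferInstance hi.2 hβ hi'
  rw [Real.dist_eq]
  linarith

/-- Vanishing distance makes all integrals of bounded continuous functions agree, which again avoids
producing an optimal plan. -/
theorem eq_of_W2_eq_zero {K : Set (Eucl d)} (hK : IsCompact K) {α β : Measure (Eucl d)}
    [IsProbabilityMeasure α] [IsProbabilityMeasure β] (hα : α Kᶜ = 0) (hβ : β Kᶜ = 0)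
    (h : W2 α β = 0) : α = β := by
  refine ext_of_forall_integral_eq_of_IsFiniteMeasure fun f => ?_
  refine sub_eq_zero.1 (abs_eq_zero.1 (le_antisymm ?_ (abs_nonneg _)))
  refine le_of_forall_pos_le_add fun η hη => ?_
  obtain ⟨δ, hδ, hδη⟩ := exists_forall_W2_lt_integral_sub_le hK f.continuous.continuousOn hη
  rw [zero_add]
  exact hδη α β inferInstance inferInstance hα hβ (by rw [h]; exact ENNReal.ofReal_pos.2 hδ)

/-- Every plan starts from K, so reaching y costs at least the squared distance from y to K. This
makes the support condition stable under W₂ limits. -/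
theorem lintegral_infEDist_sq_le {K : Set (Eucl d)} {α β : Measure (Eucl d)} (hα : α Kᶜ = 0) :
    ∫⁻ y, Metric.infEDist y K ^ 2 ∂β ≤ W2 α β ^ 2 := by
  rw [← W2sq_eq_sq]
  refine le_iInf₂ fun γ hγ => ?_
  have ha : ∀ᵐ x ∂α, x ∈ K := by rw [ae_iff]; exact hα
  have hm : Measurable fun y : Eucl d => Metric.infEDist y K ^ 2 :=
    measurable_infEDist.pow_const 2
  rw [← hγ.2, Measure.snd, lintegral_map hm measurable_snd]
  refine lintegral_mono_ae ?_
  filter_upwards [ae_fst_of_mem_plans hγ ha] with p hp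
  gcongr
  rw [enorm_sub_rev, ← edist_eq_enorm_sub]
  exact Metric.infEDist_le_edist_of_mem hp

theorem measure_compl_eq_zero_of_tendsto_W2 {K : Set (Eucl d)} (hK : IsClosed K)
    {ι : Type*}
    {l : Filter ι} [l.NeBot] {α : ι → Measure (Eucl d)} {β : Measure (Eucl d)}
    (hα : ∀ᶠ i in l, α i Kᶜ = 0) (h : Tendsto (fun i => W2 (α i) β) l (𝓝 0)) : β Kᶜ = 0 := by
  have hm : Measurable fun y : Eucl d => Metric.infEDist y K ^ 2 :=
    measurable_infEDist.pow_const 2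
  have h1 : ∫⁻ y, Metric.infEDist y K ^ 2 ∂β = 0 := by
    have h2 : Tendsto (fun i => W2 (α i) β ^ 2) l (𝓝 0) := by
      simpa using ENNReal.Tendsto.pow (n := 2) h
    exact le_antisymm (ge_of_tendsto h2 (hα.mono fun i hi => lintegral_infEDist_sq_le hi))
      (zero_le)
  rw [lintegral_eq_zero_iff hm] at h1
  have h3 : ∀ᵐ y ∂β, y ∈ K := by
    filter_upwards [h1] with y hy
    rw [Metric.mem_iff_infEDist_zero_of_closed hK]
    simpa using hy
  rwa [ae_iff] at h3

/-- A weakly continuous family of probability measures is measurable. -/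
theorem measurable_of_continuous_integral {X : Type*} [TopologicalSpace X] [MeasurableSpace X]
    [OpensMeasurableSpace X] {α : X → Measure (Eucl d)} [∀ t, IsProbabilityMeasure (α t)]
    (h : ∀ f : BoundedContinuousFunction (Eucl d) ℝ, Continuous fun t => ∫ x, f x ∂(α t)) :
    Measurable α := by
  let P : X → ProbabilityMeasure (Eucl d) := fun t => ⟨α t, inferInstance⟩
  have hP : Continuous P := ProbabilityMeasure.continuous_iff_forall_continuous_integral.2 h
  have hgen : (inferInstance : MeasurableSpace (Eucl d))
      = MeasurableSpace.generateFrom {s | IsOpen s} := BorelSpace.measurable_eq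
  -- By the portmanteau theorem the mass of an open set is lower semicontinuous in the parameter,
  -- and open sets form a generating π-system.
  refine Measurable.measure_of_isPiSystem_of_isProbabilityMeasure hgen isPiSystem_isOpen
    fun s hs => LowerSemicontinuous.measurable fun t y hy => ?_
  have := ProbabilityMeasure.le_liminf_measure_open_of_tendsto (hP.tendsto t) hs
  exact eventually_lt_of_lt_liminf (hy.trans_le this)

theorem tendsto_integral_compProd {X Ω : Type*} [MeasurableSpace X] [TopologicalSpace X]
    [MeasurableSpace Ω] [TopologicalSpace Ω] [OpensMeasurableSpace (X × Ω)]
    {P : Measure X} [IsProbabilityMeasure P]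
    {κ : ℕ → Kernel X Ω} {κ' : Kernel X Ω} [∀ n, IsMarkovKernel (κ n)] [IsMarkovKernel κ']
    (h : ∀ᵐ t ∂P, ∀ f : BoundedContinuousFunction Ω ℝ,
      Tendsto (fun n => ∫ x, f x ∂(κ n t)) atTop (𝓝 (∫ x, f x ∂(κ' t))))
    (f : BoundedContinuousFunction (X × Ω) ℝ) :
    Tendsto (fun n => ∫ z, f z ∂(P ⊗ₘ κ n)) atTop (𝓝 (∫ z, f z ∂(P ⊗ₘ κ'))) := by
  have hint : ∀ η : Kernel X Ω, IsMarkovKernel η → Integrable f (P ⊗ₘ η) := fun η _ =>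
    (integrable_const ‖f‖).mono' f.continuous.measurable.aestronglyMeasurable
      (ae_of_all _ f.norm_coe_le_norm)
  rw [Measure.integral_compProd (hint κ' inferInstance)]
  simp_rw [fun n => Measure.integral_compProd (hint (κ n) inferInstance)]
  refine tendsto_integral_of_dominated_convergence (fun _ => ‖f‖) ?_ (integrable_const _) ?_ ?_
  · exact fun n =>
      (f.continuous.measurable.stronglyMeasurable.integral_kernel_prod_right').aestronglyMeasurable
  · refine fun n => ae_of_all _ fun t => ?_
    refine (norm_integral_le_of_norm_le_const (ae_of_all _ fun x => f.norm_coe_le_norm _)).trans ?_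
    simp
  · filter_upwards [h] with t ht
    let g : BoundedContinuousFunction Ω ℝ :=
      f.compContinuous ⟨fun x => (t, x), by fun_prop⟩
    exact ht g

/-! ### The entropic velocity -/

theorem measurable_velocity (A : Eucl d →L[ℝ] Eucl d) (ε : ℝ) (μ α : Measure (Eucl d)) :
    Measurable (velocity A ε μ α) := by
  have h : StronglyMeasurable fun x : Eucl d =>
      ∫ y, y ∂((entropicPlan ε α μ : Measure (Eucl d × Eucl d)).condKernel x) :=
    StronglyMeasurable.integral_kernel_prod_right'
      (f := fun p : Eucl d × Eucl d => p.2) measurable_snd.stronglyMeasurable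
  exact A.continuous.measurable.comp (measurable_id.sub h.measurable)

theorem ae_condKernel_mem {α μ : Measure (Eucl d)} {γ : Measure (Eucl d × Eucl d)}
    [IsFiniteMeasure γ] (hγ : γ ∈ plans α μ) {p : Eucl d → Prop} (h : ∀ᵐ y ∂μ, p y) :
    ∀ᵐ x ∂α, ∀ᵐ y ∂(γ.condKernel x), p y := by
  have h1 := ae_snd_of_mem_plans hγ h
  rw [← γ.disintegrate γ.condKernel, hγ.1] at h1
  have : SFinite α := by rw [← hγ.1]; infer_instance
  exact Measure.ae_ae_of_ae_compProd h1

/-- The conditional mean of y stays in the ball of radius R₀ that carries `μ`. -/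
theorem ae_norm_velocity_le {A : Eucl d →L[ℝ] Eucl d} {ε : ℝ} {α μ : Measure (Eucl d)}
    {R₀ : ℝ} (hγ : (entropicPlan ε α μ : Measure (Eucl d × Eucl d)) ∈ plans α μ)
    (hμ : ∀ᵐ y ∂μ, ‖y‖ ≤ R₀) : ∀ᵐ x ∂α, ‖velocity A ε μ α x‖ ≤ ‖A‖ * (‖x‖ + R₀) := by
  filter_upwards [ae_condKernel_mem hγ hμ] with x hx
  refine (A.le_opNorm _).trans ?_
  gcongr
  refine (norm_sub_le _ _).trans ?_
  gcongr
  simpa using norm_integral_le_of_norm_le_const hx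

/-- The velocity is the conditional expectation of `A (x - y)`. -/
theorem integral_velocity {A : Eucl d →L[ℝ] Eucl d} {ε : ℝ} {α μ : Measure (Eucl d)}
    {R₀ : ℝ} (hγ : (entropicPlan ε α μ : Measure (Eucl d × Eucl d)) ∈ plans α μ)
    (hμ : ∀ᵐ y ∂μ, ‖y‖ ≤ R₀) {G : Eucl d → ℝ × Eucl d →L[ℝ] ℝ}
    (hint : Integrable (fun p : Eucl d × Eucl d => G p.1 (1, A (p.1 - p.2)))
      (entropicPlan ε α μ : Measure (Eucl d × Eucl d))) :
    ∫ x, G x (1, velocity A ε μ α x) ∂α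
      = ∫ p, G p.1 (1, A (p.1 - p.2)) ∂(entropicPlan ε α μ : Measure (Eucl d × Eucl d)) := by
  set γ := (entropicPlan ε α μ : Measure (Eucl d × Eucl d)) with hγdef
  have : SFinite α := by rw [← hγ.1]; infer_instance
  have hdis : α ⊗ₘ γ.condKernel = γ := by
    have h := γ.disintegrate γ.condKernel
    rwa [hγ.1] at h
  conv_rhs => rw [← hdis]
  rw [Measure.integral_compProd (by rwa [hdis])]
  refine integral_congr_ae ?_
  filter_upwards [ae_condKernel_mem hγ hμ] with x hx
  have hy : Integrable (fun y : Eucl d => y) (γ.condKernel x) :=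
    (integrable_const R₀).mono' measurable_id.aestronglyMeasurable hx
  have h1 : Integrable (fun y : Eucl d => x - y) (γ.condKernel x) := (integrable_const x).sub hy
  -- For fixed x both `A` and `G x` are linear, hence commute with the conditional mean in y.
  have h2 : velocity A ε μ α x = ∫ y, A (x - y) ∂(γ.condKernel x) := by
    rw [A.integral_comp_comm h1, integral_sub (integrable_const x) hy]
    simp [velocity, ← hγdef]
  have h3 : Integrable (fun y : Eucl d => ((1 : ℝ), A (x - y))) (γ.condKernel x) :=
    (integrable_const (1 : ℝ)).prodMk (A.integrable_comp h1)
  have h4 := (G x).integral_comp_comm h3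
  change G x (1, velocity A ε μ α x) = ∫ y, G x (1, A (x - y)) ∂(γ.condKernel x)
  rw [h4, integral_pair (integrable_const (1 : ℝ)) (A.integrable_comp h1), h2]
  simp

/-! ### Supports along the Euler scheme -/

section euler

variable {M : ℕ} {R₀ : ℝ} {x y : Fin M → Eucl d}

/-- Every atom has positive mass, so an almost sure bound on the velocity, which is defined through
a conditional kernel, holds at each particle. -/
theorem ae_empirical_iff {p : Eucl d → Prop} (hp : MeasurableSet {z | p z}) :
    (∀ᵐ z ∂(empirical x), p z) ↔ ∀ i, p (x i) := by
  constructor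
  · intro h i
    by_contra hi
    exact empirical_singleton_ne_zero x i
      (measure_mono_null (by simpa using hi) (ae_iff.1 h))
  · intro h
    exact ae_iff.2 (empirical_eq_zero_of_forall_notMem x hp.compl (by simpa using h))

/-- The quantity ‖z‖ + R₀ starts below 2R₀ and grows at most by the factor 1 + τ‖A‖ per step, since
the displacement is at most τ‖A‖(‖z‖ + R₀). This is the discrete Gronwall bound behind the radius
2R₀e^{‖A‖T}. -/
theorem exists_euler_eq_empirical (hM : 0 < M) (hx : ∀ i, ‖x i‖ ≤ R₀) (hy : ∀ i, ‖y i‖ ≤ R₀)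
    (A : Eucl d →L[ℝ] Eucl d) (ε : ℝ) {τ : ℝ} (hτ : 0 ≤ τ) (k : ℕ) :
    ∃ z : Fin M → Eucl d, euler A ε τ (empirical y) (empirical x) k = empirical z ∧
      ∀ i, ‖z i‖ + R₀ ≤ (1 + τ * ‖A‖) ^ k * (2 * R₀) := by
  induction k with
  | zero => exact ⟨x, rfl, fun i => by linarith [hx i]⟩
  | succ k ih =>
    obtain ⟨z, hz, hzb⟩ := ih
    have hm := measurable_velocity A ε (empirical y) (empirical z)
    have hμ : ∀ᵐ y' ∂(empirical y), ‖y'‖ ≤ R₀ :=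
      (ae_empirical_iff (measurableSet_le measurable_norm measurable_const)).2 hy
    have hv := ae_norm_velocity_le (A := A) (entropicPlan_empirical_spec z ε y hM).1 hμ
    rw [ae_empirical_iff (measurableSet_le hm.norm (by fun_prop))] at hv
    refine ⟨(fun w => w + τ • velocity A ε (empirical y) (empirical z) w) ∘ z, ?_, fun i => ?_⟩
    · rw [euler, hz]
      exact map_empirical z (measurable_id.add (hm.const_smul τ))
    · have h1 : ‖z i + τ • velocity A ε (empirical y) (empirical z) (z i)‖
          ≤ ‖z i‖ + τ * (‖A‖ * (‖z i‖ + R₀)) := by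
        refine (norm_add_le _ _).trans ?_
        rw [norm_smul, Real.norm_of_nonneg hτ]
        gcongr
        exact hv i
      calc _ ≤ ‖z i‖ + τ * (‖A‖ * (‖z i‖ + R₀)) + R₀ := by gcongr; exact h1
        _ = (1 + τ * ‖A‖) * (‖z i‖ + R₀) := by ring
        _ ≤ (1 + τ * ‖A‖) * ((1 + τ * ‖A‖) ^ k * (2 * R₀)) := by
          gcongr
          exact hzb i
        _ = _ := by ring

/-- The radius of a ball that carries all the measures of the Euler scheme up to time `T`. -/
abbrev growthRadius (A : Eucl d →L[ℝ] Eucl d) (R₀ T : ℝ) : ℝ := 2 * R₀ * Real.exp (‖A‖ * T)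

theorem euler_mem_probBall (hM : 0 < M) (hR₀ : 0 < R₀) (hx : ∀ i, ‖x i‖ ≤ R₀)
    (hy : ∀ i, ‖y i‖ ≤ R₀) (A : Eucl d →L[ℝ] Eucl d) (ε : ℝ) {τ T : ℝ} (hτ : 0 ≤ τ) {k : ℕ}
    (hk : k * τ ≤ T) :
    euler A ε τ (empirical y) (empirical x) k ∈ probBall d (growthRadius A R₀ T) := by
  obtain ⟨z, hz, hzb⟩ := exists_euler_eq_empirical hM hx hy A ε hτ k
  rw [hz]
  refine ⟨isProbabilityMeasure_empirical z hM, ?_⟩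
  refine empirical_eq_zero_of_forall_notMem z Metric.isClosed_closedBall.measurableSet.compl ?_
  intro i
  rw [Set.notMem_compl_iff, mem_closedBall_zero_iff]
  have h1 : (1 + τ * ‖A‖) ^ k ≤ Real.exp (‖A‖ * T) := by
    calc (1 + τ * ‖A‖) ^ k ≤ Real.exp (τ * ‖A‖) ^ k := by
          gcongr
          linarith [Real.add_one_le_exp (τ * ‖A‖)]
      _ = Real.exp (‖A‖ * (k * τ)) := by rw [← Real.exp_nat_mul]; ring_nf
      _ ≤ _ := by gcongr
  have h2 : (1 + τ * ‖A‖) ^ k * (2 * R₀) ≤ Real.exp (‖A‖ * T) * (2 * R₀) := by gcongr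
  have := hzb i
  rw [growthRadius]
  linarith

theorem isEntropicPlan_euler (hM : 0 < M) (hx : ∀ i, ‖x i‖ ≤ R₀) (hy : ∀ i, ‖y i‖ ≤ R₀)
    (A : Eucl d →L[ℝ] Eucl d) (ε : ℝ) {τ : ℝ} (hτ : 0 ≤ τ) (k : ℕ) :
    IsEntropicPlan ε (euler A ε τ (empirical y) (empirical x) k) (empirical y)
      (entropicPlan ε (euler A ε τ (empirical y) (empirical x) k) (empirical y) :
        Measure (Eucl d × Eucl d)) := by
  obtain ⟨z, hz, -⟩ := exists_euler_eq_empirical hM hx hy A ε hτ k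
  rw [hz]
  exact entropicPlan_empirical_spec z ε y hM

end euler

/-! ### Taylor expansion and the discrete weak formulation -/

/-- A first order expansion of a `C¹` function, uniform on compact sets. -/
theorem exists_forall_taylor {T R C : ℝ} (hC : 0 ≤ C) (hT : 0 < T) {F : ℝ × Eucl d → ℝ}
    (hF : ContDiffOn ℝ 1 F (Set.Icc 0 T ×ˢ Set.univ)) {ω : ℝ} (hω : 0 < ω) :
    ∃ τ₀ : ℝ, 0 < τ₀ ∧ ∀ τ : ℝ, 0 ≤ τ → τ ≤ τ₀ →
      (∀ (t : ℝ) (x v : Eucl d), 0 ≤ t → t + τ ≤ T → x ∈ Metric.closedBall 0 R →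
        x + τ • v ∈ Metric.closedBall 0 R → ‖v‖ ≤ C →
        |F (t + τ, x + τ • v) - F (t, x)
          - τ * fderivWithin ℝ F (Set.Icc 0 T ×ˢ Set.univ) (t, x) (1, v)| ≤ ω * τ) ∧
      (∀ (s t : ℝ) (x v : Eucl d), s ∈ Set.Icc 0 T → t ∈ Set.Icc 0 T → |s - t| ≤ τ →
        x ∈ Metric.closedBall 0 R → ‖v‖ ≤ C →
        |fderivWithin ℝ F (Set.Icc 0 T ×ˢ Set.univ) (s, x) (1, v)
          - fderivWithin ℝ F (Set.Icc 0 T ×ˢ Set.univ) (t, x) (1, v)| ≤ ω) := by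
  set S : Set (ℝ × Eucl d) := Set.Icc 0 T ×ˢ Set.univ with hS
  set K : Set (ℝ × Eucl d) := Set.Icc 0 T ×ˢ Metric.closedBall 0 R with hK
  have hKS : K ⊆ S := Set.prod_mono_right (Set.subset_univ _)
  have hUD : UniqueDiffOn ℝ S := (uniqueDiffOn_Icc hT).prod uniqueDiffOn_univ
  have hG : ContinuousOn (fderivWithin ℝ F S) S := hF.continuousOn_fderivWithin hUD le_rfl
  have hKc : IsCompact K := isCompact_Icc.prod (isCompact_closedBall _ _)
  obtain ⟨r, hr, hmod⟩ := Metric.uniformContinuousOn_iff_le.1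
    (hKc.uniformContinuousOn_of_continuous (hG.mono hKS)) (ω / (1 + C)) (by positivity)
  have hnorm : ∀ v : Eucl d, ‖v‖ ≤ C → ‖((1 : ℝ), v)‖ ≤ 1 + C := fun v hv => by
    rw [Prod.norm_mk]
    refine max_le ?_ (by linarith)
    rw [norm_one]
    linarith
  -- The direction (1, v) has norm at most 1 + C, so a step τ ≤ r/(1 + C) stays within r of its base
  -- point, where the derivative varies by at most ω/(1 + C).
  refine ⟨r / (1 + C), by positivity, fun τ hτ hττ₀ => ⟨?_, ?_⟩⟩
  · intro t x v ht htT hx hxv hv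
    set p : ℝ × Eucl d := (t, x) with hp
    set q : ℝ × Eucl d := (t + τ, x + τ • v) with hq
    have hqp : q - p = τ • ((1 : ℝ), v) := by simp [hp, hq]
    have hnqp : ‖q - p‖ ≤ τ * (1 + C) := by
      rw [hqp, norm_smul, Real.norm_of_nonneg hτ]
      gcongr
      exact hnorm v hv
    have hr' : τ * (1 + C) ≤ r := by rwa [← le_div_iff₀ (by positivity)]
    set s : Set (ℝ × Eucl d) := K ∩ Metric.closedBall p r with hs
    have hpK : p ∈ K := ⟨⟨ht, by linarith⟩, hx⟩
    have hqK : q ∈ K := ⟨⟨by linarith, htT⟩, hxv⟩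
    have hps : p ∈ s := ⟨hpK, Metric.mem_closedBall_self hr.le⟩
    have hqs : q ∈ s := ⟨hqK, by rw [Metric.mem_closedBall, dist_eq_norm]; linarith⟩
    have hconv : Convex ℝ s :=
      ((convex_Icc 0 T).prod (convex_closedBall _ _)).inter (convex_closedBall _ _)
    have hder : ∀ z ∈ s, HasFDerivWithinAt F (fderivWithin ℝ F S z) s z := fun z hz =>
      ((hF.differentiableOn one_ne_zero z (hKS hz.1)).hasFDerivWithinAt).mono
        (Set.inter_subset_left.trans hKS)
    have hbd : ∀ z ∈ s, ‖fderivWithin ℝ F S z - fderivWithin ℝ F S p‖ ≤ ω / (1 + C) := by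
      intro z hz
      rw [← dist_eq_norm]
      exact hmod z hz.1 p hpK hz.2
    have key := hconv.norm_image_sub_le_of_norm_hasFDerivWithin_le' hder hbd hps hqs
    rw [hqp, map_smul, smul_eq_mul, ← hqp, Real.norm_eq_abs] at key
    refine key.trans ?_
    calc ω / (1 + C) * ‖q - p‖ ≤ ω / (1 + C) * (τ * (1 + C)) := by gcongr
      _ = ω * τ := by field_simp
  · intro s t x v hs ht hst hx hv
    have hd : dist (s, x) (t, x) ≤ r := by
      rw [Prod.dist_eq, dist_self, Real.dist_eq]
      refine max_le ?_ hr.le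
      have : r / (1 + C) ≤ r := div_le_self hr.le (by linarith)
      linarith
    have := hmod (s, x) ⟨hs, hx⟩ (t, x) ⟨ht, hx⟩ hd
    rw [dist_eq_norm] at this
    rw [← sub_apply, ← Real.norm_eq_abs]
    calc _ ≤ ‖fderivWithin ℝ F S (s, x) - fderivWithin ℝ F S (t, x)‖ * ‖((1 : ℝ), v)‖ :=
          ContinuousLinearMap.le_opNorm _ _
      _ ≤ ω / (1 + C) * (1 + C) := by
          gcongr
          exact hnorm v hv
      _ = ω := by field_simp

theorem floor_div_eq {τ s : ℝ} (hτ : 0 < τ) {k : ℕ} (h1 : k * τ ≤ s) (h2 : s < (k + 1) * τ) :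
    ⌊s / τ⌋₊ = k := by
  have h0 : 0 ≤ s / τ := div_nonneg (le_trans (by positivity) h1) hτ.le
  rw [Nat.floor_eq_iff h0]
  exact ⟨by rwa [le_div_iff₀ hτ], by rwa [div_lt_iff₀ hτ]⟩

/-- The entropic plans along the Euler scheme, as a kernel in the time variable. -/
def eulerKernel (A : Eucl d →L[ℝ] Eucl d) (ε τ : ℝ) (μ a : Measure (Eucl d)) :
    Kernel ℝ (Eucl d × Eucl d) where
  toFun s := entropicPlan ε (eulerCurve A ε τ μ a s) μ
  -- The family depends on s only through the step index, and every map out of ℕ is measurable.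
  measurable' :=
    (measurable_from_top (f := fun k : ℕ =>
      (entropicPlan ε (euler A ε τ μ a k) μ : Measure (Eucl d × Eucl d)))).comp
      (Nat.measurable_floor.comp (measurable_id.div_const τ))

theorem eulerKernel_apply (A : Eucl d →L[ℝ] Eucl d) (ε τ : ℝ) (μ a : Measure (Eucl d)) (s : ℝ) :
    eulerKernel A ε τ μ a s = entropicPlan ε (eulerCurve A ε τ μ a s) μ := rfl

instance (A : Eucl d →L[ℝ] Eucl d) (ε τ : ℝ) (μ a : Measure (Eucl d)) :
    IsMarkovKernel (eulerKernel A ε τ μ a) where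
  isProbabilityMeasure s := by
    rw [eulerKernel_apply]
    infer_instance

theorem measurable_integral_kernel {κ : Kernel ℝ (Eucl d × Eucl d)} [IsMarkovKernel κ]
    (H : BoundedContinuousFunction (ℝ × Eucl d × Eucl d) ℝ) :
    Measurable fun s => ∫ p, H (s, p) ∂(κ s) :=
  (H.continuous.measurable.stronglyMeasurable.integral_kernel_prod_right').measurable

theorem norm_integral_kernel_le {κ : Kernel ℝ (Eucl d × Eucl d)} [IsMarkovKernel κ]
    (H : BoundedContinuousFunction (ℝ × Eucl d × Eucl d) ℝ) (s : ℝ) :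
    ‖∫ p, H (s, p) ∂(κ s)‖ ≤ ‖H‖ := by
  simpa using norm_integral_le_of_norm_le_const (μ := κ s)
    (ae_of_all _ fun p => H.norm_coe_le_norm (s, p))

theorem intervalIntegrable_integral_kernel {κ : Kernel ℝ (Eucl d × Eucl d)} [IsMarkovKernel κ]
    (H : BoundedContinuousFunction (ℝ × Eucl d × Eucl d) ℝ) (a b : ℝ) :
    IntervalIntegrable (fun s => ∫ p, H (s, p) ∂(κ s)) volume a b :=
  (intervalIntegrable_const (c := ‖H‖)).mono_fun
    (measurable_integral_kernel H).aestronglyMeasurable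
    (ae_of_all _ fun s => (norm_integral_kernel_le H s).trans (by simp))

section discrete

variable {M : ℕ} {R₀ T τ ε : ℝ} {x y : Fin M → Eucl d} {A : Eucl d →L[ℝ] Eucl d}

theorem integrable_empirical (z : Fin M → Eucl d) (f : Eucl d → ℝ) :
    Integrable f (empirical z) := by
  by_cases hM : M = 0
  · subst hM
    simp [empirical]
  · exact (integrable_finsetSum_measure.2 fun i _ => integrable_dirac (by simp)).smul_measure
      (by simpa using hM)

/-- The weak formulation holds along the Euler scheme, up to an error controlled by the first order
expansion of the test function. -/
theorem abs_euler_weak_le (hM : 0 < M) (hR₀ : 0 < R₀) (hx : ∀ i, ‖x i‖ ≤ R₀)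
    (hy : ∀ i, ‖y i‖ ≤ R₀) (hτ : 0 < τ) {F : ℝ × Eucl d → ℝ}
    {G : ℝ × Eucl d → ℝ × Eucl d →L[ℝ] ℝ} (hFc : ContinuousOn F (Set.Icc 0 T ×ˢ Set.univ))
    (H : BoundedContinuousFunction (ℝ × Eucl d × Eucl d) ℝ)
    (hH : ∀ (t : ℝ) (x y : Eucl d), t ∈ Set.Icc 0 T →
      x ∈ Metric.closedBall 0 (growthRadius A R₀ T) → ‖y‖ ≤ R₀ →
      H (t, x, y) = G (t, x) (1, A (x - y)))
    {ω : ℝ}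
    (h1 : ∀ (t : ℝ) (x v : Eucl d), 0 ≤ t → t + τ ≤ T →
      x ∈ Metric.closedBall 0 (growthRadius A R₀ T) →
      x + τ • v ∈ Metric.closedBall 0 (growthRadius A R₀ T) →
      ‖v‖ ≤ ‖A‖ * (growthRadius A R₀ T + R₀) →
      |F (t + τ, x + τ • v) - F (t, x) - τ * G (t, x) (1, v)| ≤ ω * τ)
    (h2 : ∀ (s t : ℝ) (x v : Eucl d), s ∈ Set.Icc 0 T → t ∈ Set.Icc 0 T → |s - t| ≤ τ →
      x ∈ Metric.closedBall 0 (growthRadius A R₀ T) →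
      ‖v‖ ≤ ‖A‖ * (growthRadius A R₀ T + R₀) →
      |G (s, x) (1, v) - G (t, x) (1, v)| ≤ ω) (k : ℕ) (hk : k * τ ≤ T) :
    |∫ z, F (k * τ, z) ∂(euler A ε τ (empirical y) (empirical x) k)
        - ∫ z, F (0, z) ∂(empirical x)
        - ∫ s in (0 : ℝ)..(k * τ),
          ∫ p, H (s, p) ∂(eulerKernel A ε τ (empirical y) (empirical x) s)| ≤ 2 * ω * (k * τ) := by
  set R := growthRadius A R₀ T with hR
  set B := Metric.closedBall (0 : Eucl d) R with hB
  set J : ℝ → ℝ := fun s =>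
    ∫ p, H (s, p) ∂(eulerKernel A ε τ (empirical y) (empirical x) s) with hJ
  have hBc : IsCompact B := isCompact_closedBall _ _
  have hμ : ∀ᵐ y' ∂(empirical y), ‖y'‖ ≤ R₀ :=
    (ae_empirical_iff (measurableSet_le measurable_norm measurable_const)).2 hy
  induction k with
  | zero => simp [euler]
  | succ k ih =>
    have hkτ : (k : ℝ) * τ + τ ≤ T := by
      rw [← add_one_mul]
      exact_mod_cast hk
    have hk0 : 0 ≤ (k : ℝ) * τ := by positivity
    have hkT : (k : ℝ) * τ ≤ T := by linarith
    have hkI : (k : ℝ) * τ ∈ Set.Icc 0 T := ⟨hk0, hkT⟩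
    have ih := ih hkT
    set α := euler A ε τ (empirical y) (empirical x) k with hα
    set α' := euler A ε τ (empirical y) (empirical x) (k + 1) with hα'
    obtain ⟨_, hαB⟩ := euler_mem_probBall hM hR₀ hx hy A ε hτ.le hkT
    rw [← hα] at hαB
    obtain ⟨_, hαB'⟩ := euler_mem_probBall hM hR₀ hx hy A ε hτ.le hk
    rw [← hα'] at hαB'
    have hspec := (isEntropicPlan_euler hM hx hy A ε hτ.le k).1
    rw [← hα] at hspec
    set γ := (entropicPlan ε α (empirical y) : Measure (Eucl d × Eucl d)) with hγ
    set vel := velocity A ε (empirical y) α with hvel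
    have hvm : Measurable vel := measurable_velocity A ε (empirical y) α
    have hmap : α' = α.map fun z => z + τ • vel z := rfl
    have hmm : Measurable fun z => z + τ • vel z := measurable_id.add (hvm.const_smul τ)
    have hae : ∀ᵐ z ∂α, z ∈ B := by rw [ae_iff]; exact hαB
    have hae' : ∀ᵐ z ∂α', z ∈ B := by rw [ae_iff]; exact hαB'
    have hnext : ∀ᵐ z ∂α, z + τ • vel z ∈ B := by
      rw [hmap] at hae'
      exact ae_of_ae_map hmm.aemeasurable hae'
    have hvb : ∀ᵐ z ∂α, ‖vel z‖ ≤ ‖A‖ * (R + R₀) := by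
      filter_upwards [ae_norm_velocity_le (A := A) hspec hμ, hae] with z hz hzB
      rw [hB, mem_closedBall_zero_iff] at hzB
      exact hz.trans (by gcongr)
    have hslice : ∀ t ∈ Set.Icc 0 T, ContinuousOn (fun z => F (t, z)) B := fun t ht =>
      hFc.comp (by fun_prop) fun z _ => ⟨ht, Set.mem_univ z⟩
    have hkI' : (k : ℝ) * τ + τ ∈ Set.Icc 0 T := ⟨by positivity, hkτ⟩
    have hi0 : Integrable (fun z => F (k * τ, z)) α :=
      integrable_of_continuousOn hBc hαB (hslice _ hkI)
    have hi1' : Integrable (fun z => F (k * τ + τ, z)) α' :=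
      integrable_of_continuousOn hBc hαB' (hslice _ hkI')
    have hi1 : Integrable (fun z => F (k * τ + τ, z + τ • vel z)) α := by
      rw [hmap] at hi1'
      exact hi1'.comp_measurable hmm
    have hpB : ∀ᵐ p ∂γ, p.1 ∈ B ∧ ‖p.2‖ ≤ R₀ :=
      (ae_fst_of_mem_plans hspec hae).and (ae_snd_of_mem_plans hspec hμ)
    have hHint : ∀ s, Integrable (fun p => H (s, p)) γ := fun s =>
      (integrable_const ‖H‖).mono'
        (H.continuous.comp (by fun_prop : Continuous fun p : Eucl d × Eucl d => (s, p))
          |>.measurable.aestronglyMeasurable)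
        (ae_of_all _ fun p => H.norm_coe_le_norm (s, p))
    have hHG : (fun p : Eucl d × Eucl d => H (k * τ, p))
        =ᵐ[γ] fun p => G (k * τ, p.1) (1, A (p.1 - p.2)) := by
      filter_upwards [hpB] with p hp
      exact hH _ p.1 p.2 hkI hp.1 hp.2
    have hGint := (hHint (k * τ)).congr hHG
    have hvelint := integral_velocity (G := fun z => G (k * τ, z)) hspec hμ hGint
    have hJk : ∫ p, H (k * τ, p) ∂γ = ∫ z, G (k * τ, z) (1, vel z) ∂α := by
      rw [hvelint]
      exact integral_congr_ae hHG
    -- First error: the Taylor remainder of one Euler step, at most ωτ after averaging over the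
    -- particles.
    have e1 : |∫ z, F (k * τ + τ, z) ∂α' - ∫ z, F (k * τ, z) ∂α
        - τ * ∫ p, H (k * τ, p) ∂γ| ≤ ω * τ := by
      have h3 : ∫ z, F (k * τ + τ, z) ∂α' = ∫ z, F (k * τ + τ, z + τ • vel z) ∂α := by
        rw [hmap, integral_map hmm.aemeasurable]
        rw [← hmap]
        exact hi1'.aestronglyMeasurable
      have hbound : ∀ᵐ z ∂α, ‖F (k * τ + τ, z + τ • vel z) - F (k * τ, z)
          - τ * G (k * τ, z) (1, vel z)‖ ≤ ω * τ := by
        filter_upwards [hae, hnext, hvb] with z hz1 hz2 hz3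
        exact h1 _ z (vel z) hk0 hkτ hz1 hz2 hz3
      have hGi : Integrable (fun z => G (k * τ, z) (1, vel z)) α := by
        obtain ⟨z, hz, -⟩ := exists_euler_eq_empirical hM hx hy A ε hτ.le k
        rw [hα, hz]
        exact integrable_empirical z _
      rw [h3, hJk, ← integral_const_mul, ← integral_sub hi1 hi0]
      refine le_of_eq_of_le (congrArg _ (integral_sub (hi1.sub hi0) (hGi.const_mul τ)).symm) ?_
      rw [← Real.norm_eq_abs]
      simpa using norm_integral_le_of_norm_le_const hbound
    -- Second error: within the step the plan is constant and only the time argument of H moves,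
    -- which again costs at most ωτ. The two errors give the factor 2 in the bound.
    have e2 : |(∫ s in (k * τ)..(k * τ + τ), J s) - τ * ∫ p, H (k * τ, p) ∂γ| ≤ ω * τ := by
      have hJi : IntervalIntegrable J volume (k * τ) (k * τ + τ) :=
        intervalIntegrable_integral_kernel H _ _
      have h3 : (∫ s in (k * τ)..(k * τ + τ), J s) - τ * ∫ p, H (k * τ, p) ∂γ
          = ∫ s in (k * τ)..(k * τ + τ), (J s - ∫ p, H (k * τ, p) ∂γ) := by
        rw [intervalIntegral.integral_sub hJi intervalIntegrable_const]
        simp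
      rw [h3, ← Real.norm_eq_abs]
      refine (intervalIntegral.norm_integral_le_of_norm_le_const_ae (C := ω) ?_).trans_eq ?_
      · have hne : ∀ᵐ s : ℝ, s ≠ k * τ + τ := by
          rw [ae_iff]
          simp
        filter_upwards [hne] with s hs hsI
        rw [Set.uIoc_of_le (by linarith)] at hsI
        have hsI2 : s < k * τ + τ := lt_of_le_of_ne hsI.2 hs
        have hfl : ⌊s / τ⌋₊ = k := floor_div_eq hτ hsI.1.le (by linarith)
        have hker : eulerKernel A ε τ (empirical y) (empirical x) s = γ := by
          rw [eulerKernel_apply, eulerCurve, hfl]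
        simp only [hJ, hker]
        rw [← integral_sub (hHint s) (hHint (k * τ))]
        have hsT : s ∈ Set.Icc 0 T := ⟨by linarith [hsI.1], by linarith⟩
        have hbound : ∀ᵐ p ∂γ, ‖H (s, p) - H (k * τ, p)‖ ≤ ω := by
          filter_upwards [hpB] with p hp
          have e1 : H (s, p) = G (s, p.1) (1, A (p.1 - p.2)) := hH s p.1 p.2 hsT hp.1 hp.2
          have e2 : H (k * τ, p) = G (k * τ, p.1) (1, A (p.1 - p.2)) :=
            hH _ p.1 p.2 hkI hp.1 hp.2
          rw [e1, e2]
          refine h2 s (k * τ) p.1 _ hsT hkI ?_ hp.1 ?_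
          · rw [abs_of_nonneg (by linarith [hsI.1])]
            linarith
          · refine (A.le_opNorm _).trans ?_
            gcongr
            refine (norm_sub_le _ _).trans (add_le_add ?_ hp.2)
            exact mem_closedBall_zero_iff.1 hp.1
        simpa using norm_integral_le_of_norm_le_const hbound
      · rw [add_sub_cancel_left, abs_of_pos hτ]
    have hcast : ((k + 1 : ℕ) : ℝ) * τ = k * τ + τ := by push_cast; ring
    rw [hcast, ← intervalIntegral.integral_add_adjacent_intervals
      (intervalIntegrable_integral_kernel H 0 (k * τ))
      (intervalIntegrable_integral_kernel H (k * τ) (k * τ + τ))]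
    change |_ - _ - ((∫ s in (0 : ℝ)..(k * τ), J s) + ∫ s in (k * τ)..(k * τ + τ), J s)| ≤ _
    rw [abs_le] at ih e1 e2 ⊢
    constructor <;> linarith [ih.1, ih.2, e1.1, e1.2, e2.1, e2.2]

end discrete

/-! ### Limit points of time-dependent plans -/

section limit

variable {Ω Y : Type*} [MeasurableSpace Ω] [MeasurableSpace Y] {P : Measure ℝ}
  [IsProbabilityMeasure P]

theorem map_compProd_eq {g : Ω → Y} (hg : Measurable g) (κ : Kernel ℝ Ω) [IsMarkovKernel κ] :
    (P ⊗ₘ κ).map (fun z => (z.1, g z.2)) = P ⊗ₘ κ.map g := by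
  have := Kernel.IsMarkovKernel.map κ hg
  have hm : Measurable fun z : ℝ × Ω => (z.1, g z.2) := by fun_prop
  ext s hs
  rw [Measure.map_apply hm hs, Measure.compProd_apply (hm hs), Measure.compProd_apply hs]
  refine lintegral_congr fun t => ?_
  rw [Kernel.map_apply' _ hg _ (measurable_prodMk_left hs)]
  rfl

/-- Time-dependent probability measures that are carried by a fixed compact set have a limit point,
in the weak topology for the joint laws. -/
theorem exists_limit_kernel [TopologicalSpace Ω] [PolishSpace Ω] [BorelSpace Ω] [Nonempty Ω]
    {κ : ℕ → Kernel ℝ Ω} [∀ n, IsMarkovKernel (κ n)] {K : Set (ℝ × Ω)} (hK : IsCompact K)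
    (h : ∀ n, (P ⊗ₘ κ n) Kᶜ = 0) :
    ∃ (l : Filter ℕ) (κ' : Kernel ℝ Ω), l.NeBot ∧ l ≤ atTop ∧ IsMarkovKernel κ' ∧
      (P ⊗ₘ κ') Kᶜ = 0 ∧ ∀ f : BoundedContinuousFunction (ℝ × Ω) ℝ,
        Tendsto (fun n => ∫ z, f z ∂(P ⊗ₘ κ n)) l (𝓝 (∫ z, f z ∂(P ⊗ₘ κ'))) := by
  let Q : ℕ → ProbabilityMeasure (ℝ × Ω) := fun n => ⟨P ⊗ₘ κ n, inferInstance⟩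
  let := TopologicalSpace.upgradeIsCompletelyMetrizable Ω
  -- Prokhorov's theorem with tolerance 0: the probability measures carried by K form a compact set.
  have hcomp := isCompact_setOfPred_probabilityMeasure_mass_eq_compl_isCompact_le
    (E := ℝ × Ω) (u := fun _ => 0) (K := fun _ => K) tendsto_const_nhds (fun _ => hK)
    (Or.inl inferInstance)
  -- An ultrafilter finer than `atTop` replaces the extraction of a subsequence.
  let 𝓤 : Ultrafilter ℕ := Ultrafilter.of atTop
  have hU : (𝓤 : Filter ℕ) ≤ atTop := Ultrafilter.of_le atTop
  obtain ⟨Γ, hΓK, hΓ⟩ := hcomp.ultrafilter_le_nhds' (𝓤.map Q)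
    (Ultrafilter.mem_map.2 (Filter.Eventually.of_forall fun n _ => by
      have : (Q n) Kᶜ = 0 := (ProbabilityMeasure.null_iff_toMeasure_null _ _).2 (h n)
      exact this.le))
  have hQ : Tendsto Q 𝓤 (𝓝 Γ) := hΓ
  rw [ProbabilityMeasure.tendsto_iff_forall_integral_tendsto] at hQ
  -- Test functions of t alone have constant integrals along the sequence, so the time marginal
  -- survives and the limit can be disintegrated over `P`.
  have hfst : (Γ : Measure (ℝ × Ω)).fst = P := by
    refine ext_of_forall_integral_eq_of_IsFiniteMeasure fun f => ?_
    let g : BoundedContinuousFunction (ℝ × Ω) ℝ := f.compContinuous ⟨Prod.fst, continuous_fst⟩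
    have h1 := hQ g
    have h2 : ∀ n, ∫ z, g z ∂(Q n : Measure (ℝ × Ω)) = ∫ t, f t ∂P := by
      intro n
      have : P = (P ⊗ₘ κ n).fst := (Measure.fst_compProd P (κ n)).symm
      conv_rhs => rw [this, Measure.fst, integral_map measurable_fst.aemeasurable
        f.continuous.measurable.aestronglyMeasurable]
      rfl
    simp only [h2] at h1
    rw [Measure.fst, integral_map measurable_fst.aemeasurable
      f.continuous.measurable.aestronglyMeasurable]
    exact tendsto_nhds_unique h1 tendsto_const_nhds |>.symm ▸ rfl
  have hdis : P ⊗ₘ (Γ : Measure (ℝ × Ω)).condKernel = Γ := by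
    have h1 := (Γ : Measure (ℝ × Ω)).disintegrate (Γ : Measure (ℝ × Ω)).condKernel
    rwa [hfst] at h1
  refine ⟨𝓤, (Γ : Measure (ℝ × Ω)).condKernel, inferInstance, hU, inferInstance, ?_, ?_⟩
  · rw [hdis]
    have := hΓK 0
    exact (ProbabilityMeasure.null_iff_toMeasure_null _ _).1 (le_antisymm this zero_le)
  · rw [hdis]
    exact hQ

/-- Images of a limit point are determined by pointwise limits of the images. -/
theorem ae_map_eq_of_tendsto [TopologicalSpace Ω] [PolishSpace Ω] [BorelSpace Ω]
    [TopologicalSpace Y] [PolishSpace Y] [BorelSpace Y]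
    {κ : ℕ → Kernel ℝ Ω} [∀ n, IsMarkovKernel (κ n)]
    {κ' : Kernel ℝ Ω} [IsMarkovKernel κ'] {l : Filter ℕ} [l.NeBot] (hl : l ≤ atTop)
    (h : ∀ f : BoundedContinuousFunction (ℝ × Ω) ℝ,
        Tendsto (fun n => ∫ z, f z ∂(P ⊗ₘ κ n)) l (𝓝 (∫ z, f z ∂(P ⊗ₘ κ'))))
    {g : Ω → Y} (hg : Continuous g) {η : Kernel ℝ Y} [IsMarkovKernel η]
    (hη : ∀ᵐ t ∂P, ∀ f : BoundedContinuousFunction Y ℝ,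
      Tendsto (fun n => ∫ y, f y ∂((κ n t).map g)) atTop (𝓝 (∫ y, f y ∂(η t)))) :
    ∀ᵐ t ∂P, (κ' t).map g = η t := by
  let := TopologicalSpace.upgradeIsCompletelyMetrizable Y
  have hgm := hg.measurable
  have : ∀ n, IsMarkovKernel ((κ n).map g) := fun n => Kernel.IsMarkovKernel.map _ hgm
  have : IsMarkovKernel (κ'.map g) := Kernel.IsMarkovKernel.map _ hgm
  have hm : Continuous fun z : ℝ × Ω => (z.1, g z.2) := by fun_prop
  -- The joint laws of the images converge to both sides: by weak convergence on one side, by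
  -- dominated convergence in t on the other. Disintegrations are a.e. unique.
  have key : P ⊗ₘ κ'.map g = P ⊗ₘ η := by
    refine ext_of_forall_integral_eq_of_IsFiniteMeasure fun f => ?_
    have h1 : Tendsto (fun n => ∫ z, f z ∂(P ⊗ₘ (κ n).map g)) atTop
        (𝓝 (∫ z, f z ∂(P ⊗ₘ η))) := by
      refine tendsto_integral_compProd ?_ f
      filter_upwards [hη] with t ht f
      simp only [Kernel.map_apply _ hgm]
      exact ht f
    let f' : BoundedContinuousFunction (ℝ × Ω) ℝ := f.compContinuous ⟨_, hm⟩
    have h2 : ∀ ζ : Kernel ℝ Ω, IsMarkovKernel ζ →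
        ∫ z, f z ∂(P ⊗ₘ ζ.map g) = ∫ z, f' z ∂(P ⊗ₘ ζ) := by
      intro ζ _
      rw [← map_compProd_eq hgm ζ, integral_map hm.measurable.aemeasurable
        f.continuous.measurable.aestronglyMeasurable]
      rfl
    have h3 := h f'
    rw [h2 κ' inferInstance]
    simp only [fun n => h2 (κ n) inferInstance] at h1
    exact tendsto_nhds_unique h3 (h1.mono_left hl)
  filter_upwards [Kernel.ae_eq_of_compProd_eq key] with t ht
  rw [← ht, Kernel.map_apply _ hgm]

end limit

/-! ### Optimality of the limit plans -/

/-- Entropic plans are asymptotically optimal for the quadratic cost. -/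
theorem limsup_quadCost_le {R : ℝ} {ε : ℕ → ℝ} (hε : Tendsto ε atTop (𝓝 0))
    {αn μn : ℕ → Measure (Eucl d)} [∀ n, IsProbabilityMeasure (αn n)]
    [∀ n, IsProbabilityMeasure (μn n)] {α μ : Measure (Eucl d)} [IsProbabilityMeasure α]
    [IsProbabilityMeasure μ] (hμn : ∀ n, μn n (Metric.closedBall 0 R)ᶜ = 0)
    (hα : Tendsto (fun n => W2 (αn n) α) atTop (𝓝 0))
    (hμ : Tendsto (fun n => W2 μ (μn n)) atTop (𝓝 0))
    {γ : ℕ → Measure (Eucl d × Eucl d)} (hγ : ∀ n, IsEntropicPlan (ε n) (αn n) (μn n) (γ n)) :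
    limsup (fun n => quadCost (γ n)) atTop ≤ W2sq α μ := by
  -- With δ fixed the number of cells is fixed, so the entropic term vanishes as ε → 0; δ is sent to
  -- 0 only afterwards.
  have key : ∀ δ : ℝ, 0 < δ →
      limsup (fun n => quadCost (γ n)) atTop ≤ (W2 α μ + ENNReal.ofReal (2 * δ)) ^ 2 := by
    intro δ hδ
    obtain ⟨q, hq⟩ := exists_simpleFunc_dist_le d R hδ
    have h1 : ∀ n, quadCost (γ n)
        ≤ (W2 (αn n) α + (W2 α μ + W2 μ (μn n)) + ENNReal.ofReal (2 * δ)) ^ 2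
          + ENNReal.ofReal (ε n) * (2 * (1 + q.range.card)) := by
      intro n
      have h2 := OTeps_le (α := αn n) (hμn n) q hq (ε n)
      have h3 : W2 (αn n) (μn n) ≤ W2 (αn n) α + (W2 α μ + W2 μ (μn n)) :=
        (W2_triangle _ α _).trans (add_le_add_right (W2_triangle _ _ _) _)
      calc quadCost (γ n) = 2 * (2⁻¹ * quadCost (γ n)) := by
            rw [← mul_assoc, ENNReal.mul_inv_cancel (by simp) (by simp), one_mul]
        _ ≤ 2 * OTeps (ε n) (αn n) (μn n) := by
            gcongr
            rw [← (hγ n).2, entropicCost]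
            exact le_self_add
        _ ≤ 2 * (2⁻¹ * (W2 (αn n) α + (W2 α μ + W2 μ (μn n)) + ENNReal.ofReal (2 * δ)) ^ 2
            + ENNReal.ofReal (ε n) * (1 + q.range.card)) := by
            gcongr
            refine h2.trans ?_
            gcongr
        _ = _ := by
            rw [mul_add, ← mul_assoc, ENNReal.mul_inv_cancel (by simp) (by simp), one_mul,
              mul_left_comm]
    have h4 : Tendsto (fun n =>
        (W2 (αn n) α + (W2 α μ + W2 μ (μn n)) + ENNReal.ofReal (2 * δ)) ^ 2
          + ENNReal.ofReal (ε n) * (2 * (1 + q.range.card))) atTop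
        (𝓝 ((0 + (W2 α μ + 0) + ENNReal.ofReal (2 * δ)) ^ 2
          + 0 * (2 * (1 + q.range.card)))) := by
      refine Tendsto.add ?_ ?_
      · exact ENNReal.Tendsto.pow ((hα.add (tendsto_const_nhds.add hμ)).add tendsto_const_nhds)
      · refine ENNReal.Tendsto.mul_const ?_ (Or.inr ?_)
        · have h5 := (ENNReal.continuous_ofReal.tendsto 0).comp hε
          rwa [ENNReal.ofReal_zero] at h5
        · exact ENNReal.mul_ne_top (by simp) (by simp)
    rw [zero_mul, zero_add, add_zero, add_zero] at h4
    rw [← h4.limsup_eq]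
    exact limsup_le_limsup (Eventually.of_forall h1)
  have hlim : Tendsto (fun δ : ℝ => (W2 α μ + ENNReal.ofReal (2 * δ)) ^ 2) (𝓝[>] 0)
      (𝓝 ((W2 α μ + ENNReal.ofReal (2 * 0)) ^ 2)) := by
    refine (ENNReal.Tendsto.pow (tendsto_const_nhds.add ?_)).mono_left nhdsWithin_le_nhds
    exact (ENNReal.continuous_ofReal.comp (continuous_const_mul 2)).tendsto 0
  rw [mul_zero, ENNReal.ofReal_zero, add_zero, ← W2sq_eq_sq] at hlim
  exact ge_of_tendsto hlim (eventually_mem_nhdsWithin.mono fun δ hδ => key δ hδ)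

/-- The truncated quadratic cost. -/
def truncCost (d : ℕ) (C : NNReal) :
    BoundedContinuousFunction (ℝ × Eucl d × Eucl d) NNReal :=
  BoundedContinuousFunction.mkOfBound
    ⟨fun z => min (‖z.2.1 - z.2.2‖₊ ^ 2) C, by fun_prop⟩ C (fun z w => by
      rw [NNReal.dist_eq, abs_le]
      have h1 : ((min (‖z.2.1 - z.2.2‖₊ ^ 2) C : NNReal) : ℝ) ≤ C := by
        exact_mod_cast min_le_right _ _
      have h2 : ((min (‖w.2.1 - w.2.2‖₊ ^ 2) C : NNReal) : ℝ) ≤ C := by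
        exact_mod_cast min_le_right _ _
      have h3 := (min (‖z.2.1 - z.2.2‖₊ ^ 2) C : NNReal).2
      have h4 := (min (‖w.2.1 - w.2.2‖₊ ^ 2) C : NNReal).2
      simp only [ContinuousMap.coe_mk]
      constructor <;> linarith!)

theorem truncCost_apply (C : NNReal) (z : ℝ × Eucl d × Eucl d) :
    truncCost d C z = min (‖z.2.1 - z.2.2‖₊ ^ 2) C := rfl

/-- A limit point, in the sense of joint laws, of plans that are asymptotically optimal, is
almost everywhere optimal. -/
theorem ae_quadCost_eq_W2sq {P : Measure ℝ} [IsProbabilityMeasure P]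
    {κ : ℕ → Kernel ℝ (Eucl d × Eucl d)} [∀ n, IsMarkovKernel (κ n)]
    {κ' : Kernel ℝ (Eucl d × Eucl d)} [IsMarkovKernel κ'] {l : Filter ℕ} [l.NeBot]
    (hl : l ≤ atTop)
    (h : ∀ f : BoundedContinuousFunction (ℝ × Eucl d × Eucl d) ℝ,
        Tendsto (fun n => ∫ z, f z ∂(P ⊗ₘ κ n)) l (𝓝 (∫ z, f z ∂(P ⊗ₘ κ'))))
    {α : ℝ → Measure (Eucl d)} {μ : Measure (Eucl d)} {R R₀ : ℝ}
    (hα : ∀ᵐ t ∂P, ∀ᵐ x ∂(α t), ‖x‖ ≤ R) (hμ : ∀ᵐ y ∂μ, ‖y‖ ≤ R₀)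
    (hplan : ∀ᵐ t ∂P, κ' t ∈ plans (α t) μ)
    (hopt : ∀ᵐ t ∂P, limsup (fun n => quadCost (κ n t)) atTop ≤ W2sq (α t) μ) :
    ∀ᵐ t ∂P, quadCost (κ' t) = W2sq (α t) μ := by
  -- Truncating at this level makes the cost a bounded test function without changing it where the
  -- limit plans live.
  let C : NNReal := (R + R₀).toNNReal ^ 2
  set c := truncCost d C with hc
  have hcm : Measurable fun z : ℝ × Eucl d × Eucl d => (c z : ℝ≥0∞) :=
    c.continuous.measurable.coe_nnreal_ennreal
  have hcC : ∀ z, (c z : ℝ≥0∞) ≤ C := fun z => by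
    rw [hc, truncCost_apply]
    exact_mod_cast min_le_right _ _
  have hccost : ∀ t (p : Eucl d × Eucl d), (c (t, p) : ℝ≥0∞) ≤ ‖p.1 - p.2‖ₑ ^ 2 := fun t p => by
    rw [hc, truncCost_apply, enorm_eq_nnnorm]
    exact_mod_cast min_le_left _ _
  set u : ℕ → ℝ → ℝ≥0∞ := fun n t => ∫⁻ p, c (t, p) ∂(κ n t) with hu
  have hum : ∀ n, Measurable (u n) := fun n => hcm.lintegral_kernel_prod_right'
  have huC : ∀ n, u n ≤ᵐ[P] fun _ => (C : ℝ≥0∞) := fun n => ae_of_all _ fun t =>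
    (lintegral_mono fun p => hcC (t, p)).trans_eq (by simp)
  set g : ℝ → ℝ≥0∞ := fun t => limsup (fun n => u n t) atTop with hg
  have hgm : Measurable g := Measurable.limsup hum
  have h1 : Tendsto (fun n => ∫⁻ t, u n t ∂P) l (𝓝 (∫⁻ t, ∫⁻ p, c (t, p) ∂(κ' t) ∂P)) := by
    let Q : ℕ → ProbabilityMeasure (ℝ × Eucl d × Eucl d) := fun n => ⟨P ⊗ₘ κ n, inferInstance⟩
    let Q' : ProbabilityMeasure (ℝ × Eucl d × Eucl d) := ⟨P ⊗ₘ κ', inferInstance⟩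
    have hQ : Tendsto Q l (𝓝 Q') :=
      ProbabilityMeasure.tendsto_iff_forall_integral_tendsto.2 h
    have := ProbabilityMeasure.tendsto_iff_forall_lintegral_tendsto.1 hQ c
    rw [← Measure.lintegral_compProd hcm]
    refine this.congr fun n => ?_
    exact Measure.lintegral_compProd hcm
  -- Reverse Fatou lemma, legitimate because the truncated costs are bounded by C.
  have h2 : ∫⁻ t, ∫⁻ p, c (t, p) ∂(κ' t) ∂P ≤ ∫⁻ t, g t ∂P := by
    rw [← h1.limsup_eq]
    refine (limsup_le_limsup_of_le hl).trans ?_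
    exact limsup_lintegral_le (fun _ => (C : ℝ≥0∞)) hum huC (by simp)
  have h3 : ∀ᵐ t ∂P, ∫⁻ p, c (t, p) ∂(κ' t) = quadCost (κ' t) := by
    filter_upwards [hα, hplan] with t ht hpt
    refine lintegral_congr_ae ?_
    filter_upwards [ae_fst_of_mem_plans hpt ht, ae_snd_of_mem_plans hpt hμ] with p hp1 hp2
    have : ‖p.1 - p.2‖₊ ≤ (R + R₀).toNNReal := by
      rw [← NNReal.coe_le_coe, coe_nnnorm]
      exact ((norm_sub_le _ _).trans (add_le_add hp1 hp2)).trans (Real.le_coe_toNNReal _)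
    rw [hc, truncCost_apply, enorm_eq_nnnorm, min_eq_left (pow_le_pow_left' this 2)]
    simp
  have hle1 : ∀ᵐ t ∂P, g t ≤ W2sq (α t) μ := by
    filter_upwards [hopt] with t ht
    exact (limsup_le_limsup (Eventually.of_forall fun n => lintegral_mono (hccost t))).trans ht
  have hle2 : ∀ᵐ t ∂P, W2sq (α t) μ ≤ quadCost (κ' t) := by
    filter_upwards [hplan] with t ht using iInf₂_le (κ' t) ht
  have hqm : Measurable fun t => quadCost (κ' t) := Measurable.lintegral_kernel measurable_cost
  have hfin : ∫⁻ t, g t ∂P ≠ ∞ := by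
    have : ∫⁻ t, g t ∂P ≤ C := by
      calc _ ≤ ∫⁻ _, (C : ℝ≥0∞) ∂P := by
            refine lintegral_mono fun t => ?_
            exact limsup_le_of_le (h := Eventually.of_forall fun n =>
              (lintegral_mono fun p => hcC (t, p)).trans_eq (by simp))
        _ = C := by simp
    exact ne_top_of_le_ne_top (by simp) this
  -- Here g ≤ W₂² ≤ cost a.e., while the integral of the cost is at most the finite integral of g,
  -- so all three agree a.e.
  have heq : g =ᵐ[P] fun t => quadCost (κ' t) := by
    refine ae_eq_of_ae_le_of_lintegral_le ?_ hfin hqm.aemeasurable ?_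
    · filter_upwards [hle1, hle2] with t a b using a.trans b
    · rwa [← lintegral_congr_ae h3]
  filter_upwards [heq, hle1, hle2] with t a b b'
  exact le_antisymm (a ▸ b) b'

/-! ### Averaging in time and derivatives of test functions -/

/-- The uniform probability measure on `[0, T]`. -/
def uniformTime (T : ℝ) : Measure ℝ := (ENNReal.ofReal T)⁻¹ • volume.restrict (Set.Icc 0 T)

theorem isProbabilityMeasure_uniformTime {T : ℝ} (hT : 0 < T) :
    IsProbabilityMeasure (uniformTime T) := by
  constructor
  rw [uniformTime, Measure.smul_apply, Measure.restrict_apply_univ, Real.volume_Icc, sub_zero,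
    smul_eq_mul, ENNReal.inv_mul_cancel (by simpa using hT) (by simp)]

theorem ae_uniformTime_iff {T : ℝ} {p : ℝ → Prop} :
    (∀ᵐ t ∂(uniformTime T), p t) ↔ ∀ᵐ t ∂(volume.restrict (Set.Icc 0 T)), p t := by
  rw [uniformTime, Measure.ae_ennreal_smul_measure_iff (by simp)]

theorem ae_uniformTime_mem_Ico (T : ℝ) : ∀ᵐ t ∂(uniformTime T), t ∈ Set.Ico 0 T := by
  rw [ae_uniformTime_iff]
  have hne : ∀ᵐ s ∂(volume.restrict (Set.Icc 0 T)), s ≠ T :=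
    ae_restrict_of_ae (by rw [ae_iff]; simp)
  filter_upwards [hne, ae_restrict_mem measurableSet_Icc] with t ht htI
  exact ⟨htI.1, lt_of_le_of_ne htI.2 ht⟩

theorem intervalIntegral_eq_mul_integral_compProd {T : ℝ} (hT : 0 < T)
    {κ : Kernel ℝ (Eucl d × Eucl d)} [IsMarkovKernel κ]
    (H : BoundedContinuousFunction (ℝ × Eucl d × Eucl d) ℝ) :
    ∫ t in (0 : ℝ)..T, ∫ p, H (t, p) ∂(κ t) = T * ∫ z, H z ∂(uniformTime T ⊗ₘ κ) := by
  have := isProbabilityMeasure_uniformTime hT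
  have hint : Integrable H (uniformTime T ⊗ₘ κ) :=
    (integrable_const ‖H‖).mono' H.continuous.measurable.aestronglyMeasurable
      (ae_of_all _ H.norm_coe_le_norm)
  rw [Measure.integral_compProd hint, uniformTime, integral_smul_measure,
    integral_Icc_eq_integral_Ioc, intervalIntegral.integral_of_le hT.le, ENNReal.toReal_inv,
    ENNReal.toReal_ofReal hT.le, smul_eq_mul, mul_inv_cancel_left₀ hT.ne']

theorem ae_norm_le_of_measure_compl {α : Measure (Eucl d)} {R : ℝ}
    (h : α (Metric.closedBall 0 R)ᶜ = 0) : ∀ᵐ x ∂α, ‖x‖ ≤ R := by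
  have : ∀ᵐ x ∂α, x ∈ Metric.closedBall 0 R := by rw [ae_iff]; exact h
  filter_upwards [this] with x hx using mem_closedBall_zero_iff.1 hx

/-- Along a `W₂`-continuous curve of measures with bounded supports, the integrals of continuous
functions are continuous. -/
theorem continuous_integral_projIcc {T R : ℝ} (hT : 0 ≤ T) {α : ℝ → Measure (Eucl d)}
    (hα : ∀ t ∈ Set.Icc 0 T, α t ∈ probBall d R) (hαc : W2ContinuousOn T α)
    (f : BoundedContinuousFunction (Eucl d) ℝ) :
    Continuous fun t : ℝ => ∫ x, f x ∂(α (Set.projIcc 0 T hT t)) := by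
  have h : Continuous fun t : Set.Icc 0 T => ∫ x, f x ∂(α t) := by
    rw [continuous_iff_continuousAt]
    intro t
    have := (hα t t.2).1
    refine tendsto_integral_of_tendsto_W2 (isCompact_closedBall 0 R) f.continuous.continuousOn
      (Eventually.of_forall fun s => hα s s.2) (hα t t.2).2 ?_
    exact (hαc t t.2).comp (tendsto_nhdsWithin_iff.2
      ⟨continuous_subtype_val.tendsto t, Eventually.of_forall fun s => s.2⟩)
  exact h.comp continuous_projIcc

section derivatives

variable {T : ℝ} {f : ℝ → Eucl d → ℝ}

theorem derivWithin_eq_fderivWithin (hT : 0 < T)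
    (hf : ContDiffOn ℝ 1 (fun p : ℝ × Eucl d => f p.1 p.2) (Set.Icc 0 T ×ˢ Set.univ)) {t : ℝ}
    (ht : t ∈ Set.Icc 0 T) (x : Eucl d) :
    derivWithin (fun s => f s x) (Set.Icc 0 T) t
      = fderivWithin ℝ (fun p : ℝ × Eucl d => f p.1 p.2) (Set.Icc 0 T ×ˢ Set.univ) (t, x)
        (1, 0) := by
  have h1 := (hf.differentiableOn one_ne_zero (t, x) ⟨ht, Set.mem_univ x⟩).hasFDerivWithinAt
  have h2 : HasDerivWithinAt (fun s : ℝ => (s, x)) ((1 : ℝ), (0 : Eucl d)) (Set.Icc 0 T) t :=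
    (hasDerivWithinAt_id t _).prodMk (hasDerivWithinAt_const t _ x)
  have hmaps : Set.MapsTo (fun s : ℝ => (s, x)) (Set.Icc 0 T)
      (Set.Icc 0 T ×ˢ (Set.univ : Set (Eucl d))) := fun s hs => ⟨hs, Set.mem_univ x⟩
  have h3 := h1.comp_hasDerivWithinAt t h2 hmaps
  exact h3.derivWithin (uniqueDiffOn_Icc hT t ht)

/-- A time slice of the strip is all of space, so the derivative within the strip restricts to a
full gradient, even at t = 0 and t = T. -/
theorem inner_gradient_eq_fderivWithin
    (hf : ContDiffOn ℝ 1 (fun p : ℝ × Eucl d => f p.1 p.2) (Set.Icc 0 T ×ˢ Set.univ)) {t : ℝ}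
    (ht : t ∈ Set.Icc 0 T) (x v : Eucl d) :
    inner ℝ v (gradient (f t) x)
      = fderivWithin ℝ (fun p : ℝ × Eucl d => f p.1 p.2) (Set.Icc 0 T ×ˢ Set.univ) (t, x)
        (0, v) := by
  have h1 := (hf.differentiableOn one_ne_zero (t, x) ⟨ht, Set.mem_univ x⟩).hasFDerivWithinAt
  have h2 : HasFDerivWithinAt (fun z : Eucl d => (t, z))
      (ContinuousLinearMap.inr ℝ ℝ (Eucl d)) Set.univ x :=
    (hasFDerivAt_prodMk_right t x).hasFDerivWithinAt
  have h3 := (h1.comp x h2 fun z _ => ⟨ht, Set.mem_univ z⟩).hasFDerivAt univ_mem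
  have h4 : fderiv ℝ (f t) x = _ := h3.fderiv
  rw [real_inner_comm, gradient, InnerProductSpace.toDual_symm_apply, h4]
  simp

end derivatives

/-- A function that is continuous on a compact set of parameters extends to a bounded continuous
function. -/
theorem exists_boundedContinuous_extension {Ω : Type*} [TopologicalSpace Ω] [NormalSpace Ω]
    [T2Space Ω] {K : Set Ω} (hK : IsCompact K) {h : Ω → ℝ} (hh : ContinuousOn h K) :
    ∃ H : BoundedContinuousFunction Ω ℝ, ∀ z ∈ K, H z = h z := by
  have : CompactSpace K := isCompact_iff_compactSpace.1 hK
  let h₀ : BoundedContinuousFunction K ℝ :=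
    BoundedContinuousFunction.mkOfCompact ⟨K.domRestrict h, hh.domRestrict⟩
  obtain ⟨H, -, hH⟩ := h₀.exists_norm_eq_domRestrict_eq_of_closed hK.isClosed
  exact ⟨H, fun z hz => congrArg (fun k => k ⟨z, hz⟩) hH⟩

/-! ### Passage to the limit in the scheme -/

section convergence

variable {A : Eucl d →L[ℝ] Eucl d} {R₀ T : ℝ} {α₀ μ₀ : Measure (Eucl d)} {ε : ℕ → ℝ}
  {N M : ℕ → ℕ} {x y : (n : ℕ) → Fin (M n) → Eucl d} {α : ℝ → Measure (Eucl d)}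

theorem eulerCurve_mem_probBall (hR₀ : 0 < R₀) {M : ℕ} (hM : 0 < M) {x y : Fin M → Eucl d}
    (hx : ∀ i, ‖x i‖ ≤ R₀) (hy : ∀ i, ‖y i‖ ≤ R₀) {ε τ : ℝ} (hτ : 0 < τ) {t : ℝ}
    (ht : t ∈ Set.Icc 0 T) :
    eulerCurve A ε τ (empirical y) (empirical x) t ∈ probBall d (growthRadius A R₀ T) := by
  refine euler_mem_probBall hM hR₀ hx hy A ε hτ.le ?_
  have := Nat.floor_le (div_nonneg ht.1 hτ.le)
  rw [le_div_iff₀ hτ] at this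
  exact this.trans ht.2

theorem mem_probBall_of_tendsto (hT : 0 < T) {R : ℝ} (hα : ∀ t ∈ Set.Icc 0 T,
      IsProbabilityMeasure (α t)) (hαc : W2ContinuousOn T α)
    {β : ℕ → ℝ → Measure (Eucl d)} (hβ : ∀ n, ∀ t ∈ Set.Icc 0 T, β n t ∈ probBall d R)
    (h : ∀ t ∈ Set.Ico 0 T, Tendsto (fun n => W2 (β n t) (α t)) atTop (𝓝 0)) :
    ∀ t ∈ Set.Icc 0 T, α t ∈ probBall d R := by
  have h1 : ∀ t ∈ Set.Ico 0 T, α t (Metric.closedBall 0 R)ᶜ = 0 := fun t ht =>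
    measure_compl_eq_zero_of_tendsto_W2 Metric.isClosed_closedBall
      (Eventually.of_forall fun n => (hβ n t (Set.Ico_subset_Icc_self ht)).2) (h t ht)
  intro t ht
  refine ⟨hα t ht, ?_⟩
  rcases ht.2.lt_or_eq with htT | rfl
  · exact h1 t ⟨ht.1, htT⟩
  -- Nothing is assumed about the scheme at time T; the support of `α T` comes from the earlier
  -- times by W₂ continuity.
  · have hne : (𝓝[Set.Ico 0 t] t).NeBot :=
      mem_closure_iff_nhdsWithin_neBot.1 (by
        rw [closure_Ico hT.ne]
        exact ht)
    refine measure_compl_eq_zero_of_tendsto_W2 (l := 𝓝[Set.Ico 0 t] t)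
      Metric.isClosed_closedBall ?_
      ((hαc t ht).mono_left (nhdsWithin_mono _ Set.Ico_subset_Icc_self))
    exact eventually_mem_nhdsWithin.mono h1

/-- The weak formulation is inherited by limit points of the entropic plans. -/
theorem weak_formulation_of_tendsto (hR₀ : 0 < R₀) (hT : 0 < T) (hα₀ : α₀ ∈ probBall d R₀)
    (hN : ∀ n, 0 < N n) (hM : ∀ n, 0 < M n)
    (hx : ∀ n i, ‖x n i‖ ≤ R₀) (hy : ∀ n i, ‖y n i‖ ≤ R₀)
    (hτ : Tendsto (fun n => T / N n) atTop (𝓝 0))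
    (ha : Tendsto (fun n => W2 (empirical (x n)) α₀) atTop (𝓝 0))
    (hαB : ∀ t ∈ Set.Icc 0 T, α t ∈ probBall d (growthRadius A R₀ T))
    (hαc : W2ContinuousOn T α)
    (hcluster : Tendsto (fun n => ⨆ t ∈ Set.Ico 0 T,
        W2 (eulerCurve A (ε n) (T / N n) (empirical (y n)) (empirical (x n)) t) (α t))
      atTop (𝓝 0))
    {κ' : Kernel ℝ (Eucl d × Eucl d)} [IsMarkovKernel κ'] {l : Filter ℕ} [l.NeBot]
    (hl : l ≤ atTop)
    (hκ : ∀ f : BoundedContinuousFunction (ℝ × Eucl d × Eucl d) ℝ,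
        Tendsto (fun n => ∫ z, f z ∂(uniformTime T ⊗ₘ
          eulerKernel A (ε n) (T / N n) (empirical (y n)) (empirical (x n)))) l
          (𝓝 (∫ z, f z ∂(uniformTime T ⊗ₘ κ'))))
    {F : ℝ × Eucl d → ℝ} (hF : ContDiffOn ℝ 1 F (Set.Icc 0 T ×ˢ Set.univ))
    {H : BoundedContinuousFunction (ℝ × Eucl d × Eucl d) ℝ}
    (hH : ∀ (t : ℝ) (x y : Eucl d), t ∈ Set.Icc 0 T →
      x ∈ Metric.closedBall 0 (growthRadius A R₀ T) → ‖y‖ ≤ R₀ →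
      H (t, x, y) = fderivWithin ℝ F (Set.Icc 0 T ×ˢ Set.univ) (t, x) (1, A (x - y))) :
    ∫ t in (0 : ℝ)..T, ∫ p, H (t, p) ∂(κ' t)
      = ∫ z, F (T, z) ∂(α T) - ∫ z, F (0, z) ∂α₀ := by
  set R := growthRadius A R₀ T with hR
  set B := Metric.closedBall (0 : Eucl d) R with hB
  have hRpos : 0 < R := by positivity
  have hR₀R : R₀ ≤ R := by
    have : 1 ≤ Real.exp (‖A‖ * T) := Real.one_le_exp (by positivity)
    rw [hR, growthRadius]
    nlinarith
  have hBc : IsCompact B := isCompact_closedBall _ _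
  set τ : ℕ → ℝ := fun n => T / N n with hτdef
  have hτpos : ∀ n, 0 < τ n := fun n => div_pos hT (Nat.cast_pos.2 (hN n))
  -- Uniform convergence covers only t < T, so the scheme is stopped at its last node before T, one
  -- step early.
  set k : ℕ → ℕ := fun n => N n - 1 with hk
  have hkτ : ∀ n, (k n : ℝ) * τ n + τ n = T := by
    intro n
    have h1 : ((k n : ℝ) + 1) = N n := by
      rw [hk]
      exact_mod_cast Nat.sub_add_cancel (hN n)
    have h2 : (N n : ℝ) ≠ 0 := Nat.cast_ne_zero.2 (hN n).ne'
    rw [← add_one_mul, h1, hτdef]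
    field_simp
  have hkT : ∀ n, (k n : ℝ) * τ n ≤ T := fun n => by linarith [hkτ n, hτpos n]
  have hk0 : ∀ n, 0 ≤ (k n : ℝ) * τ n := fun n =>
    mul_nonneg (Nat.cast_nonneg _) (hτpos n).le
  have hTI : T ∈ Set.Icc 0 T := ⟨hT.le, le_rfl⟩
  have h0I : (0 : ℝ) ∈ Set.Icc 0 T := ⟨le_rfl, hT.le⟩
  have hkI : ∀ n, (k n : ℝ) * τ n ∈ Set.Icc 0 T := fun n => ⟨hk0 n, hkT n⟩
  have hkτT : Tendsto (fun n => (k n : ℝ) * τ n) atTop (𝓝 T) := by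
    have h1 : Tendsto (fun n => T - τ n) atTop (𝓝 (T - 0)) := tendsto_const_nhds.sub hτ
    rw [sub_zero] at h1
    exact h1.congr fun n => by linarith [hkτ n]
  set β : ℕ → Measure (Eucl d) := fun n =>
    euler A (ε n) (τ n) (empirical (y n)) (empirical (x n)) (k n) with hβ
  have hβB : ∀ n, β n ∈ probBall d R := fun n =>
    euler_mem_probBall (hM n) hR₀ (hx n) (hy n) A (ε n) (hτpos n).le (hkT n)
  set J : ℕ → ℝ → ℝ := fun n t => ∫ p, H (t, p)
    ∂(eulerKernel A (ε n) (τ n) (empirical (y n)) (empirical (x n)) t) with hJ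
  have hslice : ∀ t ∈ Set.Icc 0 T, ContinuousOn (fun z => F (t, z)) B := fun t ht =>
    hF.continuousOn.comp (by fun_prop) fun z _ => ⟨ht, Set.mem_univ z⟩
  -- the defect in the weak formulation tends to zero
  have hE : Tendsto (fun n => ∫ z, F (k n * τ n, z) ∂(β n) - ∫ z, F (0, z) ∂(empirical (x n))
      - ∫ s in (0 : ℝ)..(k n * τ n), J n s) atTop (𝓝 0) := by
    rw [Metric.tendsto_nhds]
    intro η hη
    -- The choice ω = η/(4T) turns the accumulated error 2ωkτ ≤ 2ωT into η/2.
    obtain ⟨τ₀, hτ₀, htay⟩ := exists_forall_taylor (R := R) (C := ‖A‖ * (R + R₀))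
      (by positivity) hT hF (ω := η / (4 * T)) (by positivity)
    filter_upwards [hτ.eventually (gt_mem_nhds hτ₀)] with n hn
    obtain ⟨h1, h2⟩ := htay (τ n) (hτpos n).le (le_of_lt hn)
    have h3 := abs_euler_weak_le (ε := ε n) (hM n) hR₀ (hx n) (hy n) (hτpos n) hF.continuousOn H hH
      h1 h2 (k n) (hkT n)
    rw [dist_zero_right, Real.norm_eq_abs]
    refine h3.trans_lt ?_
    calc 2 * (η / (4 * T)) * (k n * τ n) ≤ 2 * (η / (4 * T)) * T := by
          gcongr
          exact hkT n
      _ = η / 2 := by field_simp; norm_num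
      _ < η := by linarith
  have hW : Tendsto (fun n => W2 (β n) (α T)) atTop (𝓝 0) := by
    have h1 : Tendsto (fun n => W2 (α (k n * τ n)) (α T)) atTop (𝓝 0) :=
      (hαc T hTI).comp (tendsto_nhdsWithin_iff.2 ⟨hkτT, Eventually.of_forall hkI⟩)
    have h2 := hcluster.add h1
    rw [add_zero] at h2
    refine tendsto_of_tendsto_of_tendsto_of_le_of_le tendsto_const_nhds h2
      (fun _ => zero_le) fun n => ?_
    have := (hβB n).1
    have := (hαB _ (hkI n)).1
    refine (W2_triangle (β n) (α (k n * τ n)) (α T)).trans (add_le_add_left ?_ _)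
    have hcurve : β n = eulerCurve A (ε n) (T / N n) (empirical (y n)) (empirical (x n))
        (k n * τ n) := by
      have : ⌊k n * τ n / (T / N n)⌋₊ = k n :=
        floor_div_eq (τ := T / N n) (hτpos n) le_rfl (by
          have := hτpos n
          change (k n : ℝ) * τ n < (k n + 1) * τ n
          linarith)
      rw [eulerCurve, this]
    rw [hcurve]
    exact le_iSup₂_of_le (k n * τ n) ⟨hk0 n, by linarith [hkτ n, hτpos n]⟩ le_rfl
  have hfin : Tendsto (fun n => ∫ z, F (k n * τ n, z) ∂(β n)) atTop (𝓝 (∫ z, F (T, z) ∂(α T))) := by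
    have := (hαB T hTI).1
    have h1 := tendsto_integral_of_tendsto_W2 hBc (hslice T hTI)
      (Eventually.of_forall fun n => hβB n) (hαB T hTI).2 hW
    have h2 : Tendsto (fun n => ∫ z, F (k n * τ n, z) ∂(β n) - ∫ z, F (T, z) ∂(β n)) atTop
        (𝓝 0) := by
      rw [Metric.tendsto_nhds]
      intro η hη
      obtain ⟨r, hr, hmod⟩ := Metric.uniformContinuousOn_iff.1
        ((isCompact_Icc.prod hBc).uniformContinuousOn_of_continuous
          (hF.continuousOn.mono (Set.prod_mono_right (Set.subset_univ B)))) (η / 2) (by positivity)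
      filter_upwards [hkτT.eventually (Metric.ball_mem_nhds T hr)] with n hn
      obtain ⟨_, hβn⟩ := hβB n
      rw [dist_zero_right, ← integral_sub
        (integrable_of_continuousOn hBc hβn (hslice _ (hkI n)))
        (integrable_of_continuousOn hBc hβn (hslice _ hTI))]
      have hae : ∀ᵐ z ∂(β n), z ∈ B := by rw [ae_iff]; exact hβn
      have hbd : ∀ᵐ z ∂(β n), ‖F (k n * τ n, z) - F (T, z)‖ ≤ η / 2 := by
        filter_upwards [hae] with z hz
        rw [← dist_eq_norm]
        refine (hmod (k n * τ n, z) ⟨hkI n, hz⟩ (T, z) ⟨hTI, hz⟩ ?_).le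
        rw [Prod.dist_eq, dist_self]
        exact max_lt hn hr
      have := norm_integral_le_of_norm_le_const hbd
      rw [probReal_univ, mul_one] at this
      linarith
    have h3 := h2.add h1
    rw [zero_add] at h3
    exact h3.congr fun n => by ring
  have hini : Tendsto (fun n => ∫ z, F (0, z) ∂(empirical (x n))) atTop
      (𝓝 (∫ z, F (0, z) ∂α₀)) := by
    have := hα₀.1
    refine tendsto_integral_of_tendsto_W2 hBc (hslice 0 h0I)
      (Eventually.of_forall fun n => ?_) ?_ ha
    · have : empirical (x n) = euler A (ε n) (τ n) (empirical (y n)) (empirical (x n)) 0 := rfl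
      rw [this]
      exact euler_mem_probBall (hM n) hR₀ (hx n) (hy n) A (ε n) (hτpos n).le (by simpa using hT.le)
    · exact measure_mono_null (Set.compl_subset_compl.2 (Metric.closedBall_subset_closedBall hR₀R))
        hα₀.2
  -- The omitted last step contributes at most ‖H‖τ.
  have htail : Tendsto (fun n => ∫ s in (k n * τ n)..T, J n s) atTop (𝓝 0) := by
    have h1 : Tendsto (fun n => ‖H‖ * τ n) atTop (𝓝 (‖H‖ * 0)) := hτ.const_mul _
    rw [mul_zero] at h1
    refine squeeze_zero_norm (fun n => ?_) h1
    refine (intervalIntegral.norm_integral_le_of_norm_le_const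
      fun s _ => norm_integral_kernel_le H s).trans_eq ?_
    rw [← hkτ n, add_sub_cancel_left, abs_of_pos (hτpos n)]
  have hlim : Tendsto (fun n => ∫ s in (0 : ℝ)..T, J n s) l
      (𝓝 (∫ t in (0 : ℝ)..T, ∫ p, H (t, p) ∂(κ' t))) := by
    simp only [hJ, intervalIntegral_eq_mul_integral_compProd hT H]
    exact (hκ H).const_mul T
  have hall := ((hfin.sub hini).mono_left hl).sub (hlim.sub (htail.mono_left hl))
  have hE' : Tendsto (fun n => ∫ z, F (k n * τ n, z) ∂(β n) - ∫ z, F (0, z) ∂(empirical (x n))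
      - ((∫ s in (0 : ℝ)..T, J n s) - ∫ s in (k n * τ n)..T, J n s)) l (𝓝 0) := by
    refine (hE.mono_left hl).congr fun n => ?_
    have hadd : (∫ s in (0 : ℝ)..(k n * τ n), J n s) + ∫ s in (k n * τ n)..T, J n s
        = ∫ s in (0 : ℝ)..T, J n s :=
      intervalIntegral.integral_add_adjacent_intervals
        (intervalIntegrable_integral_kernel H 0 (k n * τ n))
        (intervalIntegrable_integral_kernel H (k n * τ n) T)
    rw [← hadd]
    ring
  have := tendsto_nhds_unique hall hE'
  linarith

/-- Uniform limits of the entropic Euler scheme are weak solutions. -/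
theorem isWeakSolution_of_tendsto (hR₀ : 0 < R₀) (hT : 0 < T) (hα₀ : α₀ ∈ probBall d R₀)
    (hμ₀ : μ₀ ∈ probBall d R₀) (hε : Tendsto ε atTop (𝓝 0))
    (hN : ∀ n, 0 < N n) (hM : ∀ n, 0 < M n)
    (hx : ∀ n i, ‖x n i‖ ≤ R₀) (hy : ∀ n i, ‖y n i‖ ≤ R₀)
    (hτ : Tendsto (fun n => T / N n) atTop (𝓝 0))
    (ha : Tendsto (fun n => W2 (empirical (x n)) α₀) atTop (𝓝 0))
    (hμ : Tendsto (fun n => W2 μ₀ (empirical (y n))) atTop (𝓝 0))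
    (hα : ∀ t ∈ Set.Icc 0 T, IsProbabilityMeasure (α t)) (hαc : W2ContinuousOn T α)
    (hcluster : Tendsto (fun n => ⨆ t ∈ Set.Ico 0 T,
        W2 (eulerCurve A (ε n) (T / N n) (empirical (y n)) (empirical (x n)) t) (α t))
      atTop (𝓝 0)) :
    IsWeakSolution A R₀ T α₀ μ₀ α := by
  set R := growthRadius A R₀ T with hR
  have hRpos : 0 < R := by positivity
  have hR₀R : R₀ ≤ R := by
    have : 1 ≤ Real.exp (‖A‖ * T) := Real.one_le_exp (by positivity)
    rw [hR, growthRadius]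
    nlinarith
  set B := Metric.closedBall (0 : Eucl d) R with hB
  have hBc : IsCompact B := isCompact_closedBall _ _
  have hτpos : ∀ n, 0 < T / N n := fun n => div_pos hT (Nat.cast_pos.2 (hN n))
  have h0I : (0 : ℝ) ∈ Set.Ico 0 T := ⟨le_rfl, hT⟩
  have : IsProbabilityMeasure α₀ := hα₀.1
  have : IsProbabilityMeasure μ₀ := hμ₀.1
  have : IsProbabilityMeasure (uniformTime T) := isProbabilityMeasure_uniformTime hT
  have hμB : ∀ n, empirical (y n) ∈ probBall d R₀ := fun n =>
    ⟨isProbabilityMeasure_empirical _ (hM n),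
      empirical_eq_zero_of_forall_notMem _ Metric.isClosed_closedBall.measurableSet.compl
        (by simpa using hy n)⟩
  have : ∀ n, IsProbabilityMeasure (empirical (y n)) := fun n => (hμB n).1
  set curve : ℕ → ℝ → Measure (Eucl d) := fun n t =>
    eulerCurve A (ε n) (T / N n) (empirical (y n)) (empirical (x n)) t with hcurve
  have hcB : ∀ n, ∀ t ∈ Set.Icc 0 T, curve n t ∈ probBall d R := fun n t ht =>
    eulerCurve_mem_probBall hR₀ (hM n) (hx n) (hy n) (hτpos n) ht
  have hpt : ∀ t ∈ Set.Ico 0 T, Tendsto (fun n => W2 (curve n t) (α t)) atTop (𝓝 0) :=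
    fun t ht => tendsto_of_tendsto_of_tendsto_of_le_of_le tendsto_const_nhds hcluster
      (fun _ => zero_le) fun n => le_iSup₂_of_le t ht le_rfl
  have hαB := mem_probBall_of_tendsto hT hα hαc hcB hpt
  have hα₀B : α₀ Bᶜ = 0 := measure_mono_null
    (Set.compl_subset_compl.2 (Metric.closedBall_subset_closedBall hR₀R)) hα₀.2
  set κ : ℕ → Kernel ℝ (Eucl d × Eucl d) := fun n =>
    eulerKernel A (ε n) (T / N n) (empirical (y n)) (empirical (x n)) with hκdef
  have : ∀ n, IsMarkovKernel (κ n) := fun n => inferInstance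
  have hκplan : ∀ n t, IsEntropicPlan (ε n) (curve n t) (empirical (y n)) (κ n t) := fun n t =>
    isEntropicPlan_euler (hM n) (hx n) (hy n) A (ε n) (hτpos n).le _
  -- a limit point of the plans
  have hKc : IsCompact (Set.Icc 0 T ×ˢ (B ×ˢ Metric.closedBall (0 : Eucl d) R₀)) :=
    isCompact_Icc.prod (hBc.prod (isCompact_closedBall _ _))
  have hK : ∀ n, (uniformTime T ⊗ₘ κ n)
      (Set.Icc 0 T ×ˢ (B ×ˢ Metric.closedBall (0 : Eucl d) R₀))ᶜ = 0 := by
    intro n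
    have h1 : ∀ᵐ z ∂(uniformTime T ⊗ₘ κ n),
        z ∈ Set.Icc 0 T ×ˢ (B ×ˢ Metric.closedBall (0 : Eucl d) R₀) := by
      refine Measure.ae_compProd_of_ae_ae hKc.measurableSet ?_
      filter_upwards [ae_uniformTime_mem_Ico T] with t ht
      have htI := Set.Ico_subset_Icc_self ht
      filter_upwards [ae_fst_of_mem_plans (hκplan n t).1
          (ae_norm_le_of_measure_compl (hcB n t htI).2),
        ae_snd_of_mem_plans (hκplan n t).1 (ae_norm_le_of_measure_compl (hμB n).2)] with p hp1 hp2
      exact ⟨htI, mem_closedBall_zero_iff.2 hp1, mem_closedBall_zero_iff.2 hp2⟩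
    rwa [ae_iff] at h1
  obtain ⟨l, κ', _, hl, _, -, hκ'⟩ := exists_limit_kernel hKc hK
  -- its marginals
  let ακ : Kernel ℝ (Eucl d) :=
    -- Outside [0,T] the curve is arbitrary; projecting the time onto the interval gives a Markov
    -- kernel on all of ℝ.
    { toFun := fun t => α (Set.projIcc 0 T hT.le t)
      measurable' := by
        have : ∀ t, IsProbabilityMeasure (α (Set.projIcc 0 T hT.le t)) := fun t =>
          hα _ (Set.projIcc 0 T hT.le t).2
        exact measurable_of_continuous_integral (continuous_integral_projIcc hT.le hαB hαc) }
  have : IsMarkovKernel ακ := ⟨fun t => hα _ (Set.projIcc 0 T hT.le t).2⟩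
  have hακ : ∀ t ∈ Set.Icc 0 T, ακ t = α t := fun t ht => by
    change α (Set.projIcc 0 T hT.le t) = α t
    rw [Set.projIcc_of_mem hT.le ht]
  have hfst : ∀ᵐ t ∂(uniformTime T), (κ' t).map Prod.fst = ακ t := by
    refine ae_map_eq_of_tendsto hl hκ' continuous_fst ?_
    filter_upwards [ae_uniformTime_mem_Ico T] with t ht f
    have htI := Set.Ico_subset_Icc_self ht
    have := hα t htI
    rw [hακ t htI]
    have h1 := tendsto_integral_of_tendsto_W2 hBc f.continuous.continuousOn
      (Eventually.of_forall fun n => hcB n t htI) (hαB t htI).2 (hpt t ht)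
    refine h1.congr fun n => ?_
    rw [← (hκplan n t).1.1, Measure.fst]
  have hsnd : ∀ᵐ t ∂(uniformTime T), (κ' t).map Prod.snd = Kernel.const ℝ μ₀ t := by
    refine ae_map_eq_of_tendsto hl hκ' continuous_snd (ae_of_all _ fun t f => ?_)
    have h1 := tendsto_integral_of_tendsto_W2 (isCompact_closedBall 0 R₀) f.continuous.continuousOn
      (Eventually.of_forall hμB) hμ₀.2 (by simpa only [W2_comm] using hμ)
    rw [Kernel.const_apply]
    refine h1.congr fun n => ?_
    rw [← (hκplan n t).1.2, Measure.snd]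
  have hplan : ∀ᵐ t ∂(uniformTime T), κ' t ∈ plans (α t) μ₀ := by
    filter_upwards [hfst, hsnd, ae_uniformTime_mem_Ico T] with t h1 h2 ht
    rw [hακ t (Set.Ico_subset_Icc_self ht)] at h1
    exact ⟨h1, h2⟩
  have hμ₀n := ae_norm_le_of_measure_compl hμ₀.2
  have hopt : ∀ᵐ t ∂(uniformTime T), quadCost (κ' t) = W2sq (α t) μ₀ := by
    refine ae_quadCost_eq_W2sq (R := R) (R₀ := R₀) hl hκ' ?_ hμ₀n hplan ?_
    · filter_upwards [ae_uniformTime_mem_Ico T] with t ht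
      exact ae_norm_le_of_measure_compl (hαB t (Set.Ico_subset_Icc_self ht)).2
    · filter_upwards [ae_uniformTime_mem_Ico T] with t ht
      have htI := Set.Ico_subset_Icc_self ht
      have := hα t htI
      have : ∀ n, IsProbabilityMeasure (curve n t) := fun n => (hcB n t htI).1
      exact limsup_quadCost_le hε (fun n => (hμB n).2) (hpt t ht) hμ fun n => hκplan n t
  have hinit : α 0 = α₀ := by
    have h0 := (hα 0 (Set.Ico_subset_Icc_self h0I))
    refine eq_of_W2_eq_zero hBc (hαB 0 (Set.Ico_subset_Icc_self h0I)).2 hα₀B ?_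
    have h1 := (hpt 0 h0I).add ha
    rw [add_zero] at h1
    refine le_antisymm (ge_of_tendsto h1 (Eventually.of_forall fun n => ?_)) zero_le
    have h2 : curve n 0 = empirical (x n) := by
      simp [hcurve, eulerCurve, euler]
    rw [h2, W2_comm _ (α 0)]
    have := isProbabilityMeasure_empirical (x n) (hM n)
    exact W2_triangle _ _ _
  refine ⟨hαc, hαB, hinit, κ', κ'.measurable, ?_, fun f hf => ?_⟩
  · rw [← ae_uniformTime_iff]
    filter_upwards [hplan, hopt] with t h1 h2 using ⟨h1, h2⟩
  -- the weak formulation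
  set F : ℝ × Eucl d → ℝ := fun p => f p.1 p.2 with hFdef
  set G := fderivWithin ℝ F (Set.Icc 0 T ×ˢ Set.univ) with hG
  have hGc : ContinuousOn G (Set.Icc 0 T ×ˢ Set.univ) :=
    hf.continuousOn_fderivWithin ((uniqueDiffOn_Icc hT).prod uniqueDiffOn_univ) le_rfl
  have hGc' : ContinuousOn (fun z : ℝ × Eucl d × Eucl d => G (z.1, z.2.1))
      (Set.Icc 0 T ×ˢ (B ×ˢ Metric.closedBall (0 : Eucl d) R₀)) :=
    hGc.comp (by fun_prop) fun z hz => ⟨hz.1, Set.mem_univ _⟩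
  -- The transport term and the plan term are extended separately, so that their time integrals can
  -- be split afterwards. Their difference is the derivative in the direction (1, A(x - y)) on the
  -- compact set.
  obtain ⟨H₁, hH₁⟩ := exists_boundedContinuous_extension hKc
    (hGc'.clm_apply (by fun_prop : ContinuousOn (fun z : ℝ × Eucl d × Eucl d =>
      ((1 : ℝ), A z.2.1)) _))
  obtain ⟨H₂, hH₂⟩ := exists_boundedContinuous_extension hKc
    (hGc'.clm_apply (by fun_prop : ContinuousOn (fun z : ℝ × Eucl d × Eucl d =>
      ((0 : ℝ), A z.2.2)) _))
  have hmain := weak_formulation_of_tendsto (F := F) (H := H₁ - H₂) hR₀ hT hα₀ hN hM hx hy hτ ha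
    hαB hαc hcluster hl hκ' hf (fun t x y ht hx hy => by
      have hmem : (t, x, y) ∈ Set.Icc 0 T ×ˢ (B ×ˢ Metric.closedBall (0 : Eucl d) R₀) :=
        ⟨ht, hx, mem_closedBall_zero_iff.2 hy⟩
      rw [BoundedContinuousFunction.sub_apply, hH₁ _ hmem, hH₂ _ hmem, ← map_sub]
      simp [hG])
  have hint : ∀ (H : BoundedContinuousFunction (ℝ × Eucl d × Eucl d) ℝ) t,
      Integrable (fun p => H (t, p)) (κ' t) := fun H t =>
    (integrable_const ‖H‖).mono'
      (H.continuous.comp (by fun_prop : Continuous fun p : Eucl d × Eucl d => (t, p))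
        |>.measurable.aestronglyMeasurable)
      (ae_of_all _ fun p => H.norm_coe_le_norm (t, p))
  have hsplit : ∫ t in (0 : ℝ)..T, ∫ p, (H₁ - H₂) (t, p) ∂(κ' t)
      = (∫ t in (0 : ℝ)..T, ∫ p, H₁ (t, p) ∂(κ' t))
        - ∫ t in (0 : ℝ)..T, ∫ p, H₂ (t, p) ∂(κ' t) := by
    rw [← intervalIntegral.integral_sub (intervalIntegrable_integral_kernel H₁ 0 T)
      (intervalIntegrable_integral_kernel H₂ 0 T)]
    refine intervalIntegral.integral_congr fun t _ => ?_
    exact integral_sub (hint H₁ t) (hint H₂ t)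
  have hcongr : ∀ {u v : ℝ → ℝ}, (∀ᵐ t ∂(uniformTime T), u t = v t) →
      ∫ t in (0 : ℝ)..T, u t = ∫ t in (0 : ℝ)..T, v t := by
    intro u v huv
    rw [ae_uniformTime_iff] at huv
    rw [intervalIntegral.integral_of_le hT.le, intervalIntegral.integral_of_le hT.le,
      ← integral_Icc_eq_integral_Ioc, ← integral_Icc_eq_integral_Ioc]
    exact integral_congr_ae huv
  have hsupp : ∀ᵐ t ∂(uniformTime T), ∀ᵐ p ∂(κ' t),
      (t, p) ∈ Set.Icc 0 T ×ˢ (B ×ˢ Metric.closedBall (0 : Eucl d) R₀) := by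
    filter_upwards [hplan, ae_uniformTime_mem_Ico T] with t hpt ht
    have htI := Set.Ico_subset_Icc_self ht
    filter_upwards [ae_fst_of_mem_plans hpt (ae_norm_le_of_measure_compl (hαB t htI).2),
      ae_snd_of_mem_plans hpt hμ₀n] with p hp1 hp2
    exact ⟨htI, mem_closedBall_zero_iff.2 hp1, mem_closedBall_zero_iff.2 hp2⟩
  have e1 : ∫ t in (0 : ℝ)..T, ∫ p, H₁ (t, p) ∂(κ' t)
      = ∫ t in (0 : ℝ)..T, ∫ x, (derivWithin (fun s => f s x) (Set.Icc 0 T) t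
            + inner ℝ (A x) (gradient (f t) x)) ∂(α t) := by
    refine hcongr ?_
    filter_upwards [hsupp, hplan, ae_uniformTime_mem_Ico T] with t hs hpt ht
    have htI := Set.Ico_subset_Icc_self ht
    have := hα t htI
    have hid : ∀ z, derivWithin (fun s => f s z) (Set.Icc 0 T) t
            + inner ℝ (A z) (gradient (f t) z) = G (t, z) (1, A z) := fun z => by
      rw [derivWithin_eq_fderivWithin hT hf htI, inner_gradient_eq_fderivWithin hf htI, ← map_add]
      simp [hG, hFdef]
    simp only [hid]
    have hcont : ContinuousOn (fun z => G (t, z) (1, A z)) B :=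
      ContinuousOn.clm_apply (hGc.comp (by fun_prop) fun z _ => ⟨htI, Set.mem_univ _⟩)
        (by fun_prop)
    have h3 := integrable_of_continuousOn hBc (hαB t htI).2 hcont
    have h4 : ∫ z, G (t, z) (1, A z) ∂(α t) = ∫ p, G (t, p.1) (1, A p.1) ∂(κ' t) := by
      have h5 := h3.aestronglyMeasurable
      rw [← hpt.1, Measure.fst] at h5 ⊢
      exact integral_map measurable_fst.aemeasurable h5
    rw [h4]
    refine integral_congr_ae ?_
    filter_upwards [hs] with p hp using hH₁ _ hp
  have e2 : ∫ t in (0 : ℝ)..T, ∫ p, H₂ (t, p) ∂(κ' t)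
      = ∫ t in (0 : ℝ)..T, ∫ p, inner ℝ (A p.2) (gradient (f t) p.1) ∂(κ' t) := by
    refine hcongr ?_
    filter_upwards [hsupp, ae_uniformTime_mem_Ico T] with t hs ht
    refine integral_congr_ae ?_
    filter_upwards [hs] with p hp
    rw [hH₂ _ hp, inner_gradient_eq_fderivWithin hf (Set.Ico_subset_Icc_self ht)]
  rw [← e1, ← e2, ← hsplit]
  exact hmain

end convergence

end SemiGeo

end

theorem theorem4p2 (d : ℕ) (A : Matrix (Fin d) (Fin d) ℝ) (R₀ T : ℝ) (hR₀ : 0 < R₀) (hT : 0 < T)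
    (α₀ μ₀ : Measure (EuclideanSpace ℝ (Fin d)))
    (hα₀ : α₀ ∈ SemiGeo.probBall d R₀) (hμ₀ : μ₀ ∈ SemiGeo.probBall d R₀)
    -- for each `ε > 0`: number of time steps, number of atoms, atoms of the two quantizations
    (N M : ℝ → ℕ) (x y : (ε : ℝ) → Fin (M ε) → EuclideanSpace ℝ (Fin d))
    (hN : ∀ ε, 0 < ε → 0 < N ε) (hM : ∀ ε, 0 < ε → 0 < M ε)
    (hx : ∀ ε, 0 < ε → ∀ i, x ε i ∈ Metric.closedBall 0 R₀)
    (hy : ∀ ε, 0 < ε → ∀ i, y ε i ∈ Metric.closedBall 0 R₀)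
    (hconv : Tendsto (fun ε => ENNReal.ofReal (T / N ε)
        + SemiGeo.W2 α₀ (SemiGeo.empirical (x ε)) + SemiGeo.W2 μ₀ (SemiGeo.empirical (y ε)))
      (𝓝[>] 0) (𝓝 0))
    -- a uniform cluster point of the discrete curves, along a sequence of positive `ε`'s
    (α : ℝ → Measure (EuclideanSpace ℝ (Fin d)))
    (hα : ∀ t ∈ Set.Icc 0 T, IsProbabilityMeasure (α t))
    (hαc : SemiGeo.W2ContinuousOn T α)
    (e : ℕ → ℝ) (he : Tendsto e atTop (𝓝[>] 0))
    (hcluster : Tendsto (fun n => ⨆ t ∈ Set.Ico 0 T,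
        SemiGeo.W2 (SemiGeo.eulerCurve (Matrix.toEuclideanCLM (𝕜 := ℝ) A) (e n) (T / N (e n))
          (SemiGeo.empirical (y (e n))) (SemiGeo.empirical (x (e n))) t) (α t))
      atTop (𝓝 0)) :
    SemiGeo.IsWeakSolution (Matrix.toEuclideanCLM (𝕜 := ℝ) A) R₀ T α₀ μ₀ α := by
  -- The hypotheses on the scheme concern ε > 0 only, so the indices where the sequence is not yet
  -- positive are dropped.
  obtain ⟨n₀, hn₀⟩ := eventually_atTop.1 (he.eventually eventually_mem_nhdsWithin)
  have hpos : ∀ n, 0 < e (n + n₀) := fun n => hn₀ (n + n₀) (Nat.le_add_left _ _)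
  have hshift : Tendsto (fun n => n + n₀) atTop atTop := tendsto_add_atTop_nat n₀
  have hsum := (hconv.comp he).comp hshift
  have hle : ∀ u : ℕ → ℝ≥0∞, (∀ n, u n ≤ ENNReal.ofReal (T / N (e (n + n₀)))
        + SemiGeo.W2 α₀ (SemiGeo.empirical (x (e (n + n₀))))
        + SemiGeo.W2 μ₀ (SemiGeo.empirical (y (e (n + n₀))))) → Tendsto u atTop (𝓝 0) :=
    fun u hu => tendsto_of_tendsto_of_tendsto_of_le_of_le tendsto_const_nhds hsum
      (fun _ => zero_le) hu
  have hτ : Tendsto (fun n => T / N (e (n + n₀))) atTop (𝓝 0) := by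
    have h1 := hle _ fun n => le_self_add.trans le_self_add
    have h2 := (ENNReal.tendsto_toReal ENNReal.zero_ne_top).comp h1
    refine h2.congr fun n => ENNReal.toReal_ofReal (by positivity)
  refine SemiGeo.isWeakSolution_of_tendsto (ε := fun n => e (n + n₀))
    (N := fun n => N (e (n + n₀))) (x := fun n => x (e (n + n₀))) (y := fun n => y (e (n + n₀)))
    hR₀ hT hα₀ hμ₀ ((he.mono_right nhdsWithin_le_nhds).comp hshift)
    (fun n => hN _ (hpos n)) (fun n => hM _ (hpos n))
    (fun n i => mem_closedBall_zero_iff.1 (hx _ (hpos n) i))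
    (fun n i => mem_closedBall_zero_iff.1 (hy _ (hpos n) i)) hτ ?_ ?_ hα hαc
    (hcluster.comp hshift)
  · refine hle _ fun n => ?_
    rw [SemiGeo.W2_comm]
    exact le_add_self.trans le_self_add
  · exact hle _ fun n => le_add_self
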